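/- **Setting.** Let $V$ be a vocabulary of $n$ words with embeddings $v_w\in\mathbb{R}^d$ ($d\ge 1$), and let $T\in\mathbb{R}^{d\times d\times d}$ be a composition tensor, with $T(x,y,z)=\sum_{i,j,k}T_{i,j,k}x_iy_jz_k$, $T(x,y,\cdot)_k=\sum_{i,j}T_{i,j,k}x_iy_j$ and $T(x,\cdot,\cdot)_{j,k}=\sum_iT_{i,j,k}x_i$. In the syntactic RAND-WALK model the discourse vectors $c_1,c_2,\dots$ follow a stationary random walk on the unit sphere of $\mathbb{R}^d$ whose stationary distribution is uniform and which satisfies $\|c_{t+1}-c_t\|\le\epsilon_w/\sqrt d$. Given the discourse vectors, each $c=c_t$ generates independently, with probability $1-p_{syn}$, a single word $w_t=w$ with probability $\exp(\langle c,v_w\rangle)/Z_c$, and, with probability $p_{syn}\in(0,1)$, a syntactic pair $(w_t,w'_t)=(a,b)$ with probability $\frac{\exp(\langle c,v_a\rangle)}{Z_c}\cdot\frac{\exp(\langle c,v_b\rangle+T(v_a,v_b,c))}{Z_{c,a}}$, where $Z_c=\sum_{w}\exp(\langle c,v_w\rangle)$ and $Z_{c,a}=\sum_w\exp(\langle c,v_w\rangle+T(v_a,v_w,c))$.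 For fixed embeddings and tensor, condition on the event that $c_t$ generates a single word and $c_{t+1}$ a syntactic pair, and put $p(a)=\Pr[w_{t+1}=a]$, $p(w,a)=\Pr[w_t=w,w_{t+1}=a]$, $p([a,b])=\Pr[w_{t+1}=a,w'_{t+1}=b]$, $p(w,[a,b])=\Pr[w_t=w,w_{t+1}=a,w'_{t+1}=b]$ and $$PMI3(a,b,w)=\log\frac{p(w,[a,b])\,p(a)\,p(b)\,p(w)}{p(w,a)\,p(w,b)\,p([a,b])}.$$ **Hypotheses.** Let $B,K,A\in\mathbb{R}$, $c_0>0$ and $m\in\mathbb{N}$ be constants. Suppose that $\|v_a\|\le B\sqrt d$ for every word $a$, and that $T$ is $(K,\epsilon)$-bounded with $\epsilon\ge0$, that is, for all words $a,b$, $$\|T(v_a,\cdot,\cdot)+I\|^2\le\frac{Kd\epsilon^2}{\log^2n},\qquad\|T(v_a,\cdot,\cdot)+I\|_F^2\le Kd,\qquad\|T(v_a,v_b,\cdot)\|^2\le Kd$$ (the first condition is read as $\log^2 n\cdot\|T(v_a,\cdot,\cdot)+I\|^2\le Kd\epsilon^2$). Suppose further that the partition functions are concentrated: there are a constant $Z$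 and, for each word $a$, a constant $Z_a$ such that, for $c$ uniform on the unit sphere, $$\Pr_c[(1-\epsilon_z)Z\le Z_c\le(1+\epsilon_z)Z]\ge1-\delta,\qquad \Pr_c[(1-\epsilon_{z,a})Z_a\le Z_{c,a}\le(1+\epsilon_{z,a})Z_a]\ge1-\delta,$$ where $0\le\epsilon_z\le A\frac{(1+\log n)^m}{\sqrt n}$, $0\le\epsilon_{z,a}\le A\big(\epsilon+\frac{(1+\log n)^m}{\sqrt n}\big)$ and $\delta\le\exp(-c_0\log^2n)$. **Conclusion.** There are constants $C$ and $q$ that depend only on $B,K,A,c_0,m$ (not on $n$, $d$, $p_{syn}$, $\epsilon$, $\epsilon_w$, the walk, the embeddings or $T$) such that for all words $a,b,w$ $$\Big|PMI3(a,b,w)-\frac1dT(v_a,v_b,v_w)\Big|\le C\Big(\epsilon+\epsilon_w+\frac{(1+\log n)^q}{\sqrt n}+\frac{(1+\log d)^q}{d}\Big),$$ that is, the error is $O(\epsilon+\epsilon_w)+\tilde O(1/\sqrt n+1/d)$. Hence the $n\times n\times n$ tensor $PMI3$ is, entrywise up to this error, equal to a tensor with a Tucker decomposition of rank $d$: its core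 is $\frac1dT$ and its three factor matrices are all the $n\times d$ matrix whose rows are the word embeddings. -/

import Mathlib

open MeasureTheory ProbabilityTheory
open scoped ENNReal ProbabilityTheory

namespace SyntacticRandWalk

noncomputable section

/-! ## Tensors -/

/-- The trilinear form `T(x, y, z) = ∑ i j k, T i j k * x i * y j * z k`. -/
def triApply {d : ℕ} (T : Fin d → Fin d → Fin d → ℝ) (x y z : EuclideanSpace ℝ (Fin d)) : ℝ :=
  ∑ i, ∑ j, ∑ k, T i j k * x i * y j * z k

/-- The vector `T(x, y, ·)`. -/
def tensorVec {d : ℕ} (T : Fin d → Fin d → Fin d → ℝ) (x y : EuclideanSpace ℝ (Fin d)) :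
    EuclideanSpace ℝ (Fin d) :=
  WithLp.toLp 2 (fun k => ∑ i, ∑ j, T i j k * x i * y j)

/-- The matrix `T(x, ·, ·)`. -/
def tensorMat {d : ℕ} (T : Fin d → Fin d → Fin d → ℝ) (x : EuclideanSpace ℝ (Fin d)) :
    Matrix (Fin d) (Fin d) ℝ :=
  Matrix.of fun j k => ∑ i, T i j k * x i

/-- `X = S(A, B, C)`: the `n × n × n` tensor `X` has the Tucker decomposition with
`d × d × d` core `S` and `n × d` factor matrices `A`, `B`, `C`. -/
def IsTuckerDecomposition {n d : ℕ} (X : Fin n → Fin n → Fin n → ℝ)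
    (S : Fin d → Fin d → Fin d → ℝ) (A B C : Matrix (Fin n) (Fin d) ℝ) : Prop :=
  ∀ i j k, X i j k = ∑ i', ∑ j', ∑ k', S i' j' k' * A i i' * B j j' * C k k'

/-- The composition tensor `T` is `(K, ε)`-bounded for the word embeddings `v`. The first norm is
the spectral norm and the second one the Frobenius norm; the first inequality is multiplied
through by `log² n`, so that nothing is divided by `log 1 = 0`. -/
structure IsBoundedTensor {n d : ℕ} (K ε : ℝ) (v : Fin n → EuclideanSpace ℝ (Fin d))
    (T : Fin d → Fin d → Fin d → ℝ) : Prop where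
  spectral : ∀ a, Real.log n ^ 2 *
    ‖Matrix.toEuclideanCLM (n := Fin d) (𝕜 := ℝ) (tensorMat T (v a) + 1)‖ ^ 2 ≤ K * d * ε ^ 2
  frobenius : ∀ a, ∑ j, ∑ k, (tensorMat T (v a) + 1) j k ^ 2 ≤ K * d
  vec : ∀ a b, ‖tensorVec T (v a) (v b)‖ ^ 2 ≤ K * d

/-! ## Discourse vectors -/

/-- Discourse vectors: the points of the unit sphere of `ℝ^d`. -/
abbrev Discourse (d : ℕ) : Type := Metric.sphere (0 : EuclideanSpace ℝ (Fin d)) 1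

/-- The uniform probability measure on the unit sphere: the normalized surface measure. -/
def uniformSphere (d : ℕ) : Measure (Discourse d) :=
  ((volume : Measure (EuclideanSpace ℝ (Fin d))).toSphere Set.univ)⁻¹ •
    (volume : Measure (EuclideanSpace ℝ (Fin d))).toSphere

/-- A transition kernel of the random walk of the discourse vectors: the uniform distribution is
stationary, and every step from `c_t` to `c_{t+1}` has length at most `εw / √d`. -/
structure IsDiscourseWalk {d : ℕ} (εw : ℝ) (walk : Kernel (Discourse d) (Discourse d)) : Prop where
  markov : IsMarkovKernel walk
  stationary : walk.Invariant (uniformSphere d)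
  step : ∀ c : Discourse d, ∀ᵐ c' : Discourse d ∂(walk c),
    ‖(c' : EuclideanSpace ℝ (Fin d)) - (c : EuclideanSpace ℝ (Fin d))‖ ≤ εw / √d

/-! ## Generation of words -/

/-- The partition function `Z_c = ∑ w, exp ⟪v_w, c⟫`. -/
def partitionFn {n d : ℕ} (v : Fin n → EuclideanSpace ℝ (Fin d)) (c : Discourse d) : ℝ :=
  ∑ w, Real.exp (inner ℝ (v w) (c : EuclideanSpace ℝ (Fin d)))

/-- The partition function `Z_{c,a} = ∑ w, exp (⟪c, v_w⟫ + T(v_a, v_w, c))`. -/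
def partitionFn₂ {n d : ℕ} (v : Fin n → EuclideanSpace ℝ (Fin d))
    (T : Fin d → Fin d → Fin d → ℝ) (a : Fin n) (c : Discourse d) : ℝ :=
  ∑ w, Real.exp (inner ℝ (c : EuclideanSpace ℝ (Fin d)) (v w) + triApply T (v a) (v w) c)

/-- The probability that `c` generates `w`, as a single word or as the root of a pair. -/
def wordProb {n d : ℕ} (v : Fin n → EuclideanSpace ℝ (Fin d)) (c : Discourse d) (w : Fin n) : ℝ :=
  Real.exp (inner ℝ (v w) (c : EuclideanSpace ℝ (Fin d))) / partitionFn v c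

/-- The probability that `c` generates `b` as the second word of a pair with root word `a`. -/
def secondProb {n d : ℕ} (v : Fin n → EuclideanSpace ℝ (Fin d))
    (T : Fin d → Fin d → Fin d → ℝ) (c : Discourse d) (a b : Fin n) : ℝ :=
  Real.exp (inner ℝ (c : EuclideanSpace ℝ (Fin d)) (v b) + triApply T (v a) (v b) c) /
    partitionFn₂ v T a c

/-- What one discourse vector generates: `inl w` is the single word `w`, and `inr (a, b)` is the
syntactic pair with root word `a` and second word `b`. -/
abbrev Output (n : ℕ) : Type := Fin n ⊕ (Fin n × Fin n)

instance (n : ℕ) : DiscreteMeasurableSpace (Output n) where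
  forall_measurableSet _ := measurableSet_sum_iff.2 ⟨.of_discrete, .of_discrete⟩

/-- The single word, or the root word of the pair. -/
def Output.root {n : ℕ} : Output n → Fin n := Sum.elim id Prod.fst

/-- The probability of each output of `c`: a single word is generated with probability
`1 - psyn`, and a syntactic pair with probability `psyn`. -/
def outputProb {n d : ℕ} (psyn : ℝ) (v : Fin n → EuclideanSpace ℝ (Fin d))
    (T : Fin d → Fin d → Fin d → ℝ) (c : Discourse d) : Output n → ℝ :=
  Sum.elim (fun w => (1 - psyn) * wordProb v c w)
    (fun ab => psyn * (wordProb v c ab.1 * secondProb v T c ab.1 ab.2))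

/-- The law of the output given the discourse vector. -/
def outputKernel {n d : ℕ} (psyn : ℝ) (v : Fin n → EuclideanSpace ℝ (Fin d))
    (T : Fin d → Fin d → Fin d → ℝ) : Kernel (Discourse d) (Output n) :=
  (Kernel.const (Discourse d) (Measure.count : Measure (Output n))).withDensity
    (fun c o => ENNReal.ofReal (outputProb psyn v T c o))

/-- The joint law of `((c_t, c_{t+1}), (output of c_t, output of c_{t+1}))` in the stationary
regime: `c_t` is uniform, `c_{t+1}` is one step of the walk away, and given the discourse vectors
the two outputs are independent. -/
def jointLaw {n d : ℕ} (psyn : ℝ) (walk : Kernel (Discourse d) (Discourse d))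
    (v : Fin n → EuclideanSpace ℝ (Fin d)) (T : Fin d → Fin d → Fin d → ℝ) :
    Measure ((Discourse d × Discourse d) × (Output n × Output n)) :=
  ((uniformSphere d) ⊗ₘ walk) ⊗ₘ (outputKernel psyn v T ∥ₖ outputKernel psyn v T)

/-- The joint law conditioned on the event that `c_t` generates a single word and `c_{t+1}`
generates a syntactic pair. -/
def condLaw {n d : ℕ} (psyn : ℝ) (walk : Kernel (Discourse d) (Discourse d))
    (v : Fin n → EuclideanSpace ℝ (Fin d)) (T : Fin d → Fin d → Fin d → ℝ) :
    Measure ((Discourse d × Discourse d) × (Output n × Output n)) :=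
  ProbabilityTheory.cond (jointLaw psyn walk v T) {x | x.2.1.isLeft ∧ x.2.2.isRight}

/-- `p(a) = Pr[w_{t+1} = a]`. -/
def pOne {n d : ℕ} (psyn : ℝ) (walk : Kernel (Discourse d) (Discourse d))
    (v : Fin n → EuclideanSpace ℝ (Fin d)) (T : Fin d → Fin d → Fin d → ℝ) (a : Fin n) : ℝ :=
  (condLaw psyn walk v T).real {x | x.2.2.root = a}

/-- `p(w, a) = Pr[w_t = w, w_{t+1} = a]`. -/
def pTwo {n d : ℕ} (psyn : ℝ) (walk : Kernel (Discourse d) (Discourse d))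
    (v : Fin n → EuclideanSpace ℝ (Fin d)) (T : Fin d → Fin d → Fin d → ℝ) (w a : Fin n) : ℝ :=
  (condLaw psyn walk v T).real {x | x.2.1.root = w ∧ x.2.2.root = a}

/-- `p([a, b]) = Pr[w_{t+1} = a, w'_{t+1} = b]`. -/
def pPair {n d : ℕ} (psyn : ℝ) (walk : Kernel (Discourse d) (Discourse d))
    (v : Fin n → EuclideanSpace ℝ (Fin d)) (T : Fin d → Fin d → Fin d → ℝ) (a b : Fin n) : ℝ :=
  (condLaw psyn walk v T).real {x | x.2.2 = Sum.inr (a, b)}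

/-- `p(w, [a, b]) = Pr[w_t = w, w_{t+1} = a, w'_{t+1} = b]`. -/
def pTriple {n d : ℕ} (psyn : ℝ) (walk : Kernel (Discourse d) (Discourse d))
    (v : Fin n → EuclideanSpace ℝ (Fin d)) (T : Fin d → Fin d → Fin d → ℝ) (w a b : Fin n) : ℝ :=
  (condLaw psyn walk v T).real {x | x.2.1.root = w ∧ x.2.2 = Sum.inr (a, b)}

/-- The pointwise mutual information of three words. -/
def PMI3 {n d : ℕ} (psyn : ℝ) (walk : Kernel (Discourse d) (Discourse d))
    (v : Fin n → EuclideanSpace ℝ (Fin d)) (T : Fin d → Fin d → Fin d → ℝ) (a b w : Fin n) : ℝ :=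
  Real.log
    (pTriple psyn walk v T w a b * pOne psyn walk v T a * pOne psyn walk v T b *
        pOne psyn walk v T w /
      (pTwo psyn walk v T w a * pTwo psyn walk v T w b * pPair psyn walk v T a b))

/-! ## Concentration of the partition functions -/

/-- The concentration events: for a uniform discourse vector `c`, with probability at least
`1 - δ`, the partition function `Z_c` lies within relative error `εz` of a constant `Z`, and, for
every word `a`, with probability at least `1 - δ`, the partition function `Z_{c,a}` lies within
relative error `εza a` of a constant `Z_a`. -/
structure ConcentrationEvents {n d : ℕ} (v : Fin n → EuclideanSpace ℝ (Fin d))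
    (T : Fin d → Fin d → Fin d → ℝ) (εz : ℝ) (εza : Fin n → ℝ) (δ : ℝ) : Prop where
  first : ∃ Z : ℝ, 1 - δ ≤ (uniformSphere d).real
    {c | (1 - εz) * Z ≤ partitionFn v c ∧ partitionFn v c ≤ (1 + εz) * Z}
  second : ∀ a, ∃ Za : ℝ, 1 - δ ≤ (uniformSphere d).real
    {c | (1 - εza a) * Za ≤ partitionFn₂ v T a c ∧ partitionFn₂ v T a c ≤ (1 + εza a) * Za}

end

end SyntacticRandWalk

/-! Put `u b = v b + T(v a, v b, ·)` (`composedVec`). Then `exp (⟪c, v b⟫ + T(v a, v b, c)) = exp ⟪u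
b, c⟫` and `Z_{c,a}` is the ordinary partition function of the family `u`. When the discourse vector
stands still, every probability in `PMI3` is therefore a mean `E [exp ⟪x, c⟫ / (Z_c ^ i * Z_{c,a} ^
j)]` over the uniform sphere (`logLinearMean`), where `x` is a sum of at most three vectors of norm
`O(√d)`.

On the sphere `E [exp ⟪x, c⟫]` is nearly Gaussian: its logarithm is `‖x‖² / (2d)` up to `O(1/d)`
(`abs_log_integral_exp_inner_sub_le`). If the partition functions concentrate, the logarithm of the
mean above is `‖x‖² / (2d) - i log Z - j log Z'` up to a small error
(`abs_log_logLinearMean_sub_le`). In the combination that forms `PMI3` the powers of `Z` and `Z'`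
cancel and so do the squared norms; the surviving cross terms are `⟪v w, u b - v b⟫ / d = T(v a, v
b, v w) / d` (`abs_staticPMI3_sub_le`).

Three errors need control. A step of the walk changes each word probability by a factor `exp
(O(εw))` (`wordProb_le_of_norm_sub_le`). The exceptional set of discourse vectors is negligible
because the log-linear integrands have size `n ^ -(i + j)` in mean even without concentration
(`logLinearMean_le`, `le_logLinearMean`), with second-moment control on small sets
(`setIntegral_exp_inner_le`). Finally, if the claimed error is not small, the same a priori bounds
show that both sides are `O(1)`, and the estimate is trivial (`abs_staticPMI3_le`). -/

namespace SyntacticRandWalk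

noncomputable section

/-! ### Moments of linear forms: from the Gaussian to the sphere -/

section Gaussian

variable {V : Type*} [NormedAddCommGroup V] [InnerProductSpace ℝ V] [FiniteDimensional ℝ V]
  [MeasurableSpace V] [BorelSpace V]

theorem integral_exp_inner_sub_sq_norm (x : V) :
    ∫ y : V, Real.exp (inner ℝ x y) * Real.exp (-(1 / 2) * ‖y‖ ^ 2) =
      (2 * Real.pi) ^ ((Module.finrank ℝ V : ℝ) / 2) * Real.exp (‖x‖ ^ 2 / 2) := by
  have h := GaussianFourier.integral_cexp_neg_mul_sq_norm_add (V := V) (b := 1 / 2)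
    (by norm_num) 1 x
  rw [← Complex.ofReal_inj, ← integral_complex_ofReal]
  have h1 : ∀ y : V, ((Real.exp (inner ℝ x y) * Real.exp (-(1 / 2) * ‖y‖ ^ 2) : ℝ) : ℂ) =
      Complex.exp (-(1 / 2) * (‖y‖ : ℂ) ^ 2 + 1 * (inner ℝ x y : ℝ)) := by
    intro y
    rw [← Real.exp_add]
    push_cast
    congr 1
    ring
  simp_rw [h1]
  rw [h, Complex.ofReal_mul, Complex.ofReal_cpow (by positivity)]
  push_cast
  congr 2
  · ring
  · ring

theorem integrable_exp_inner_sub_sq_norm (x : V) :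
    Integrable fun y : V => Real.exp (inner ℝ x y) * Real.exp (-(1 / 2) * ‖y‖ ^ 2) := by
  -- A non-integrable function has Bochner integral `0` by convention, while this integral is
  -- positive.
  refine not_imp_comm.1 integral_undef ?_
  rw [integral_exp_inner_sub_sq_norm]
  positivity

/-- The unnormalized standard Gaussian measure. -/
def gaussianWeight (V : Type*) [NormedAddCommGroup V] [InnerProductSpace ℝ V]
    [FiniteDimensional ℝ V] [MeasurableSpace V] [BorelSpace V] : Measure V :=
  volume.withDensity fun y => ENNReal.ofReal (Real.exp (-(1 / 2) * ‖y‖ ^ 2))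

theorem integral_gaussianWeight (f : V → ℝ) :
    ∫ y, f y ∂(gaussianWeight V) = ∫ y, f y * Real.exp (-(1 / 2) * ‖y‖ ^ 2) := by
  rw [gaussianWeight, integral_withDensity_eq_integral_toReal_smul (by fun_prop) (by simp)]
  simp [Real.exp_nonneg, mul_comm]

theorem integrable_gaussianWeight_iff (f : V → ℝ) :
    Integrable f (gaussianWeight V) ↔
      Integrable fun y => f y * Real.exp (-(1 / 2) * ‖y‖ ^ 2) := by
  rw [gaussianWeight, integrable_withDensity_iff (by fun_prop) (by simp)]
  simp [Real.exp_nonneg]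

theorem integrableExpSet_gaussianWeight (x : V) :
    integrableExpSet (fun y => inner ℝ x y) (gaussianWeight V) = Set.univ := by
  ext t
  simp only [integrableExpSet, Set.mem_ofPred_eq, Set.mem_univ, iff_true]
  rw [integrable_gaussianWeight_iff]
  simpa [inner_smul_left] using integrable_exp_inner_sub_sq_norm (t • x)

theorem hasDerivAt_gaussianWeight (x : V) (n : ℕ) (t : ℝ) :
    HasDerivAt (fun t => ∫ y, inner ℝ x y ^ n * Real.exp (t * inner ℝ x y) ∂(gaussianWeight V))
      (∫ y, inner ℝ x y ^ (n + 1) * Real.exp (t * inner ℝ x y) ∂(gaussianWeight V)) t :=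
  hasDerivAt_integral_pow_mul_exp_real (X := fun y : V => (inner ℝ x y : ℝ))
    (μ := gaussianWeight V) (by simp [integrableExpSet_gaussianWeight]) n

theorem mgf_gaussianWeight (x : V) (t : ℝ) :
    ∫ y, Real.exp (t * inner ℝ x y) ∂(gaussianWeight V) =
      (2 * Real.pi) ^ ((Module.finrank ℝ V : ℝ) / 2) * Real.exp (t ^ 2 * ‖x‖ ^ 2 / 2) := by
  rw [integral_gaussianWeight]
  simpa [inner_smul_left, norm_smul, mul_pow] using integral_exp_inner_sub_sq_norm (t • x)

/-- The moment generating function `M` is a multiple of `exp (t² ‖x‖² / 2)`, so `M' = ‖x‖² t M`.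
Differentiating this identity repeatedly yields the recursion for all moments, which is then read at
`t = 0`. -/
theorem gaussianWeight_first (x : V) (t : ℝ) :
    ∫ y, inner ℝ x y ^ 1 * Real.exp (t * inner ℝ x y) ∂(gaussianWeight V) =
      ‖x‖ ^ 2 * (t * ∫ y, inner ℝ x y ^ 0 * Real.exp (t * inner ℝ x y) ∂(gaussianWeight V)) := by
  have h := hasDerivAt_gaussianWeight x 0 t
  refine h.unique ?_
  simp only [pow_zero, one_mul, mgf_gaussianWeight]
  have h2 : HasDerivAt (fun t : ℝ => t ^ 2 * ‖x‖ ^ 2 / 2) (t * ‖x‖ ^ 2) t := by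
    refine (((hasDerivAt_pow 2 t).mul_const (‖x‖ ^ 2)).div_const 2).congr_deriv ?_
    push_cast
    ring
  refine ((h2.exp).const_mul ((2 * Real.pi) ^ ((Module.finrank ℝ V : ℝ) / 2))).congr_deriv ?_
  ring

theorem gaussianWeight_recursion (x : V) (n : ℕ) (t : ℝ) :
    ∫ y, inner ℝ x y ^ (n + 2) * Real.exp (t * inner ℝ x y) ∂(gaussianWeight V) =
      ‖x‖ ^ 2 *
        ((n + 1) * (∫ y, inner ℝ x y ^ n * Real.exp (t * inner ℝ x y) ∂(gaussianWeight V)) +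
          t * ∫ y, inner ℝ x y ^ (n + 1) * Real.exp (t * inner ℝ x y) ∂(gaussianWeight V)) := by
  induction n generalizing t with
  | zero =>
    refine (hasDerivAt_gaussianWeight x 1 t).unique ?_
    simp_rw [gaussianWeight_first x]
    refine (((hasDerivAt_id t).mul (hasDerivAt_gaussianWeight x 0 t)).const_mul
      (‖x‖ ^ 2)).congr_deriv ?_
    have h1 := gaussianWeight_first x t
    simp only [pow_zero, pow_one, one_mul] at h1
    simp [h1]
  | succ n ih =>
    refine (hasDerivAt_gaussianWeight x (n + 2) t).unique ?_
    simp_rw [ih]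
    refine ((((hasDerivAt_gaussianWeight x n t).const_mul _).add ((hasDerivAt_id t).mul
      (hasDerivAt_gaussianWeight x (n + 1) t))).const_mul (‖x‖ ^ 2)).congr_deriv ?_
    simp only [id_eq, ih]
    push_cast
    ring

theorem gaussian_moment_one (x : V) :
    ∫ y : V, inner ℝ x y ^ 1 * Real.exp (-(1 / 2) * ‖y‖ ^ 2) = 0 := by
  have := gaussianWeight_first x 0
  simpa [integral_gaussianWeight] using this

theorem gaussian_moment_add_two (x : V) (n : ℕ) :
    ∫ y : V, inner ℝ x y ^ (n + 2) * Real.exp (-(1 / 2) * ‖y‖ ^ 2) =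
      ‖x‖ ^ 2 * ((n + 1) * ∫ y : V, inner ℝ x y ^ n * Real.exp (-(1 / 2) * ‖y‖ ^ 2)) := by
  have := gaussianWeight_recursion x n 0
  simpa [integral_gaussianWeight] using this

/-- The radial Gaussian moment `∫ r > 0, r ^ m * exp (-r ^ 2 / 2)`. -/
def radialMoment (m : ℕ) : ℝ := ∫ r in Set.Ioi (0 : ℝ), r ^ m * Real.exp (-(1 / 2) * r ^ 2)

theorem radialMoment_eq (m : ℕ) :
    radialMoment m = (1 / 2 : ℝ) ^ (-((m : ℝ) + 1) / 2) * (1 / 2) *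
      Real.Gamma (((m : ℝ) + 1) / 2) := by
  have := integral_rpow_mul_exp_neg_mul_rpow (p := 2) (q := m) (b := 1 / 2) (by norm_num)
    (by have : (0 : ℝ) ≤ m := Nat.cast_nonneg m
        linarith) (by norm_num)
  simpa [radialMoment] using this

theorem radialMoment_pos (m : ℕ) : 0 < radialMoment m := by
  rw [radialMoment_eq]
  have : 0 < Real.Gamma (((m : ℝ) + 1) / 2) := Real.Gamma_pos_of_pos (by positivity)
  positivity

theorem radialMoment_add_two (m : ℕ) : radialMoment (m + 2) = (m + 1) * radialMoment m := by
  rw [radialMoment_eq, radialMoment_eq]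
  have h1 : (((m + 2 : ℕ) : ℝ) + 1) / 2 = ((m : ℝ) + 1) / 2 + 1 := by push_cast; ring
  have h2 : -(((m + 2 : ℕ) : ℝ) + 1) / 2 = -((m : ℝ) + 1) / 2 - 1 := by push_cast; ring
  rw [h1, h2, Real.Gamma_add_one (by positivity), Real.rpow_sub_one (by norm_num)]
  ring

/-- In polar coordinates `y = r c` the integrand is homogeneous of degree `m` times a radial weight,
so it splits; the Jacobian `r ^ (dim - 1)` shifts the radial exponent. -/
theorem integral_pow_inner_polar [Nontrivial V] (x : V) (m : ℕ) :
    ∫ y : V, inner ℝ x y ^ m * Real.exp (-(1 / 2) * ‖y‖ ^ 2) =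
      (∫ c : Metric.sphere (0 : V) 1, inner ℝ x (c : V) ^ m ∂(volume : Measure V).toSphere) *
        radialMoment (Module.finrank ℝ V - 1 + m) := by
  set μ : Measure V := volume
  calc
    ∫ y : V, inner ℝ x y ^ m * Real.exp (-(1 / 2) * ‖y‖ ^ 2) ∂μ =
        ∫ y : ({(0)}ᶜ : Set V), inner ℝ x (y : V) ^ m * Real.exp (-(1 / 2) * ‖(y : V)‖ ^ 2)
          ∂(μ.comap (↑)) := by
      rw [integral_subtype_comap (measurableSet_singleton _).compl
        fun y : V ↦ inner ℝ x y ^ m * Real.exp (-(1 / 2) * ‖y‖ ^ 2), restrict_compl_singleton]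
    _ = ∫ z : Metric.sphere (0 : V) 1 × Set.Ioi (0 : ℝ), inner ℝ x (z.1 : V) ^ m *
          ((z.2 : ℝ) ^ m * Real.exp (-(1 / 2) * (z.2 : ℝ) ^ 2))
          ∂μ.toSphere.prod (.volumeIoiPow (Module.finrank ℝ V - 1)) := by
      rw [← μ.measurePreserving_homeomorphUnitSphereProd.integral_comp
        (Homeomorph.measurableEmbedding _)]
      refine integral_congr_ae (.of_forall fun y => ?_)
      have hy : ‖(y : V)‖ ≠ 0 := norm_ne_zero_iff.2 y.2
      simp only [homeomorphUnitSphereProd_apply_fst_coe, homeomorphUnitSphereProd_apply_snd_coe,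
        inner_smul_right, mul_pow]
      have h1 : ‖(y : V)‖⁻¹ ^ m * ‖(y : V)‖ ^ m = 1 := by rw [← mul_pow, inv_mul_cancel₀ hy, one_pow]
      linear_combination (-(inner ℝ x (y : V) ^ m * Real.exp (-(1 / 2) * ‖(y : V)‖ ^ 2))) * h1
    _ = _ := by
      rw [integral_prod_mul (fun c : Metric.sphere (0 : V) 1 => inner ℝ x (c : V) ^ m)
        (fun r : Set.Ioi (0 : ℝ) => (r : ℝ) ^ m * Real.exp (-(1 / 2) * (r : ℝ) ^ 2))]
      congr 1
      simp only [Measure.volumeIoiPow, ENNReal.ofReal]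
      rw [integral_withDensity_eq_integral_smul, integral_subtype_comap measurableSet_Ioi fun a ↦
        Real.toNNReal (a ^ (Module.finrank ℝ V - 1)) • (a ^ m * Real.exp (-(1 / 2) * a ^ 2)),
        radialMoment, setIntegral_congr_fun measurableSet_Ioi fun r hr ↦ ?_]
      · simp only [NNReal.smul_def]
        rw [Real.coe_toNNReal _ (pow_nonneg (le_of_lt hr) _), smul_eq_mul, pow_add]
        ring
      · exact (measurable_subtype_coe.pow_const _).real_toNNReal

theorem sphere_moment_one [Nontrivial V] (x : V) :
    ∫ c : Metric.sphere (0 : V) 1, inner ℝ x (c : V) ^ 1 ∂(volume : Measure V).toSphere = 0 := by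
  have h := gaussian_moment_one x
  rw [integral_pow_inner_polar] at h
  exact (mul_eq_zero.1 h).resolve_right (radialMoment_pos _).ne'

/-- The radial factors of the two Gaussian moments differ by exactly `dim + m`, by
`radialMoment_add_two`. Only this ratio matters, so the surface area of the sphere is never
computed. -/
theorem sphere_moment_add_two [Nontrivial V] (x : V) (m : ℕ) :
    (Module.finrank ℝ V + m) * ∫ c : Metric.sphere (0 : V) 1, inner ℝ x (c : V) ^ (m + 2)
        ∂(volume : Measure V).toSphere =
      ‖x‖ ^ 2 * ((m + 1) * ∫ c : Metric.sphere (0 : V) 1, inner ℝ x (c : V) ^ m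
        ∂(volume : Measure V).toSphere) := by
  have h := gaussian_moment_add_two x m
  rw [integral_pow_inner_polar, integral_pow_inner_polar, ← add_assoc, radialMoment_add_two] at h
  have hd : 1 ≤ Module.finrank ℝ V := Module.finrank_pos
  push_cast [Nat.cast_sub hd] at h
  have hp := (radialMoment_pos (Module.finrank ℝ V - 1 + m)).ne'
  refine mul_right_cancel₀ hp ?_
  linear_combination h

end Gaussian

/-! ### The moment generating function of the uniform sphere -/

section SphereMgf

variable {d : ℕ} [NeZero d]

instance : IsProbabilityMeasure (uniformSphere d) where
  measure_univ := by
    have : (volume : Measure (EuclideanSpace ℝ (Fin d))).toSphere ≠ 0 := Measure.toSphere_ne_zero _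
    rw [uniformSphere, Measure.smul_apply, smul_eq_mul]
    exact ENNReal.inv_mul_cancel (Measure.measure_univ_ne_zero.2 this) (measure_ne_top _ _)

theorem integrable_uniformSphere {f : Discourse d → ℝ} (hf : Continuous f) :
    Integrable f (uniformSphere d) :=
  hf.integrable_of_hasCompactSupport (HasCompactSupport.of_compactSpace f)

omit [NeZero d] in
theorem integral_uniformSphere (f : Discourse d → ℝ) :
    ∫ c, f c ∂(uniformSphere d) =
      ((volume : Measure (EuclideanSpace ℝ (Fin d))).toSphere Set.univ)⁻¹.toReal *
        ∫ c, f c ∂(volume : Measure (EuclideanSpace ℝ (Fin d))).toSphere := by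
  rw [uniformSphere, integral_smul_measure, smul_eq_mul]

omit [NeZero d] in
theorem abs_inner_discourse_le (x : EuclideanSpace ℝ (Fin d)) (c : Discourse d) :
    |inner ℝ x (c : EuclideanSpace ℝ (Fin d))| ≤ ‖x‖ := by
  simpa using abs_real_inner_le_norm x (c : EuclideanSpace ℝ (Fin d))

theorem uniformSphere_moment_one (x : EuclideanSpace ℝ (Fin d)) :
    ∫ c, inner ℝ x (c : EuclideanSpace ℝ (Fin d)) ∂(uniformSphere d) = 0 := by
  have := sphere_moment_one x
  simp only [pow_one] at this
  rw [integral_uniformSphere, this, mul_zero]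

theorem uniformSphere_moment_add_two (x : EuclideanSpace ℝ (Fin d)) (m : ℕ) :
    (d + m) * ∫ c, inner ℝ x (c : EuclideanSpace ℝ (Fin d)) ^ (m + 2) ∂(uniformSphere d) =
      ‖x‖ ^ 2 * ((m + 1) *
        ∫ c, inner ℝ x (c : EuclideanSpace ℝ (Fin d)) ^ m ∂(uniformSphere d)) := by
  have := sphere_moment_add_two x m
  rw [finrank_euclideanSpace_fin] at this
  rw [integral_uniformSphere, integral_uniformSphere]
  linear_combination
    (((volume : Measure (EuclideanSpace ℝ (Fin d))).toSphere Set.univ)⁻¹.toReal) * this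

theorem uniformSphere_moment_odd (x : EuclideanSpace ℝ (Fin d)) (k : ℕ) :
    ∫ c, inner ℝ x (c : EuclideanSpace ℝ (Fin d)) ^ (2 * k + 1) ∂(uniformSphere d) = 0 := by
  induction k with
  | zero => simpa using uniformSphere_moment_one x
  | succ k ih =>
    have h := uniformSphere_moment_add_two x (2 * k + 1)
    rw [ih] at h
    have hd : (0 : ℝ) < d + (2 * k + 1 : ℕ) := by positivity
    simp only [mul_zero] at h
    exact (mul_eq_zero.1 h).resolve_left hd.ne'

theorem hasSum_integral_exp_inner (x : EuclideanSpace ℝ (Fin d)) :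
    HasSum (fun m : ℕ => (∫ c, inner ℝ x (c : EuclideanSpace ℝ (Fin d)) ^ m ∂(uniformSphere d)) /
        m.factorial)
      (∫ c, Real.exp (inner ℝ x (c : EuclideanSpace ℝ (Fin d))) ∂(uniformSphere d)) := by
  have h := hasSum_integral_of_summable_integral_norm (μ := uniformSphere d)
    (F := fun (m : ℕ) (c : Discourse d) =>
      inner ℝ x (c : EuclideanSpace ℝ (Fin d)) ^ m / m.factorial) ?_ ?_
  · simp only [integral_div] at h
    have he : ∀ c : Discourse d, Real.exp (inner ℝ x (c : EuclideanSpace ℝ (Fin d))) =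
        ∑' m : ℕ, inner ℝ x (c : EuclideanSpace ℝ (Fin d)) ^ m / m.factorial := by
      intro c
      rw [Real.exp_eq_exp_ℝ]
      exact (NormedSpace.expSeries_div_hasSum_exp
        (inner ℝ x (c : EuclideanSpace ℝ (Fin d)) : ℝ)).tsum_eq.symm
    simp_rw [he]
    exact h
  · intro m
    exact integrable_uniformSphere (by fun_prop)
  · refine Summable.of_nonneg_of_le (fun m => integral_nonneg fun c => norm_nonneg _)
      (fun m => ?_) (Real.summable_pow_div_factorial ‖x‖)
    have hb : ∀ c : Discourse d,
        ‖inner ℝ x (c : EuclideanSpace ℝ (Fin d)) ^ m / (m.factorial : ℝ)‖ ≤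
          ‖x‖ ^ m / m.factorial := by
      intro c
      rw [norm_div, norm_pow, Real.norm_eq_abs, Real.norm_natCast]
      gcongr
      exact abs_inner_discourse_le x c
    calc _ ≤ ∫ c : Discourse d, ‖x‖ ^ m / m.factorial ∂(uniformSphere d) :=
          integral_mono (integrable_uniformSphere (by fun_prop)) (integrable_const _) hb
      _ = _ := by simp

/-- The coefficients of the moment generating function of the uniform distribution. -/
def sphereCoeff (x : EuclideanSpace ℝ (Fin d)) (k : ℕ) : ℝ :=
  (∫ c, inner ℝ x (c : EuclideanSpace ℝ (Fin d)) ^ (2 * k) ∂(uniformSphere d)) /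
    (2 * k).factorial

theorem hasSum_sphereCoeff (x : EuclideanSpace ℝ (Fin d)) :
    HasSum (sphereCoeff x)
      (∫ c, Real.exp (inner ℝ x (c : EuclideanSpace ℝ (Fin d))) ∂(uniformSphere d)) := by
  have h := hasSum_integral_exp_inner x
  rw [← Function.Injective.hasSum_iff (g := fun k : ℕ => 2 * k)
    (fun a b h => by simpa using h)] at h
  · exact h
  · intro m hm
    obtain ⟨k, rfl⟩ : ∃ k, m = 2 * k + 1 := by
      rcases Nat.even_or_odd' m with ⟨k, rfl | rfl⟩
      · exact absurd ⟨k, rfl⟩ hm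
      · exact ⟨k, rfl⟩
    rw [uniformSphere_moment_odd, zero_div]

theorem sphereCoeff_succ (x : EuclideanSpace ℝ (Fin d)) (k : ℕ) :
    (d + 2 * k) * ((k + 1) * sphereCoeff x (k + 1)) = ‖x‖ ^ 2 / 2 * sphereCoeff x k := by
  have h := uniformSphere_moment_add_two x (2 * k)
  have hf : ((2 * k + 2).factorial : ℝ) = (2 * k + 2) * ((2 * k + 1) * (2 * k).factorial) := by
    rw [Nat.factorial_succ, Nat.factorial_succ]
    push_cast
    ring
  have hp : ((2 * k).factorial : ℝ) ≠ 0 := by positivity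
  have hk : (2 * (k : ℝ) + 1) ≠ 0 := by positivity
  have hk' : (2 * (k : ℝ) + 2) ≠ 0 := by positivity
  rw [sphereCoeff, sphereCoeff, show 2 * (k + 1) = 2 * k + 2 by ring, hf]
  push_cast at h
  field_simp
  linear_combination h

theorem sphereCoeff_zero (x : EuclideanSpace ℝ (Fin d)) : sphereCoeff x 0 = 1 := by
  simp [sphereCoeff]

/-- With `t = ‖x‖² / (2d)`, the recursion gives the coefficient `t ^ k / k!` of the Gaussian case
times `∏_{l < k} d / (d + 2l)`. Each factor lies between `1 - 2l/d` and `1`, and `∑_{l < k} 2l = k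
(k - 1)`. -/
theorem sphereCoeff_bounds (x : EuclideanSpace ℝ (Fin d)) (k : ℕ) :
    sphereCoeff x k ≤ (‖x‖ ^ 2 / (2 * d)) ^ k / k.factorial ∧
      (1 - k * (k - 1) / d) * ((‖x‖ ^ 2 / (2 * d)) ^ k / k.factorial) ≤ sphereCoeff x k := by
  have hd : (0 : ℝ) < d := Nat.cast_pos.2 (NeZero.pos d)
  induction k with
  | zero => simp [sphereCoeff_zero]
  | succ k ih =>
    obtain ⟨h1, h2⟩ := ih
    have hs := sphereCoeff_succ x k
    set t := ‖x‖ ^ 2 / (2 * d) with ht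
    have hx : ‖x‖ ^ 2 / 2 = t * d := by rw [ht]; field_simp
    have ht0 : 0 ≤ t := by positivity
    rw [hx] at hs
    have hD : (0 : ℝ) < d + 2 * k := by positivity
    have ha : sphereCoeff x (k + 1) = t / (k + 1) * (d / (d + 2 * k)) * sphereCoeff x k := by
      field_simp
      linear_combination hs
    have hb : t ^ (k + 1) / (k + 1).factorial = t / (k + 1) * (t ^ k / k.factorial) := by
      rw [Nat.factorial_succ]
      push_cast
      field_simp
      ring
    set b := t ^ k / (k.factorial : ℝ)
    have hb0 : 0 ≤ b := by positivity
    have hq : d / (d + 2 * k : ℝ) ≤ 1 := by rw [div_le_one hD]; linarith [k.cast_nonneg (α := ℝ)]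
    have hq' : 1 - 2 * k / d ≤ d / (d + 2 * k : ℝ) := by
      rw [le_div_iff₀ hD, sub_mul, div_mul_eq_mul_div, one_mul, sub_le_iff_le_add,
        ← sub_le_iff_le_add', le_div_iff₀ hd]
      nlinarith [k.cast_nonneg (α := ℝ), mul_nonneg k.cast_nonneg (k.cast_nonneg (α := ℝ))]
    have hc : 0 ≤ t / (k + 1 : ℝ) := by positivity
    have hq0 : 0 ≤ d / (d + 2 * k : ℝ) := by positivity
    rw [ha, hb]
    constructor
    · calc t / (k + 1) * (d / (d + 2 * k)) * sphereCoeff x k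
          ≤ t / (k + 1) * (d / (d + 2 * k)) * b := by gcongr
        _ ≤ t / (k + 1) * 1 * b := by gcongr
        _ = _ := by ring
    · have h3 : (1 - (k + 1) * k / d) * b ≤ d / (d + 2 * k) * sphereCoeff x k := by
        calc (1 - (k + 1) * k / d) * b
            = (1 - k * (k - 1) / d) * b - (2 * k / d) * b := by ring
          _ ≤ d / (d + 2 * k) * ((1 - k * (k - 1) / d) * b) := by
            -- `1 - k (k - 1) / d` may be negative, so the two lower bounds cannot simply be
            -- multiplied; the discarded term is `k (k - 1) / d * (1 - d / (d + 2k)) * b ≥ 0`.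
            have hk1 : 0 ≤ (k : ℝ) * (k - 1) / d := by
              rcases Nat.eq_zero_or_pos k with rfl | hk
              · simp
              · have : (1 : ℝ) ≤ k := by exact_mod_cast hk
                have := sub_nonneg.2 this
                positivity
            have h4 : 0 ≤ (1 - d / (d + 2 * k : ℝ)) := by linarith
            have h5 : 1 - d / (d + 2 * k : ℝ) ≤ 2 * k / d := by linarith
            nlinarith [mul_nonneg (mul_nonneg hk1 h4) hb0, mul_le_mul_of_nonneg_right h5 hb0]
          _ ≤ _ := by gcongr
      push_cast
      calc _ = t / (k + 1) * ((1 - (k + 1) * k / d) * b) := by ring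
        _ ≤ t / (k + 1) * (d / (d + 2 * k) * sphereCoeff x k) := by gcongr
        _ = _ := by ring

theorem integral_exp_inner_le (x : EuclideanSpace ℝ (Fin d)) :
    ∫ c, Real.exp (inner ℝ x (c : EuclideanSpace ℝ (Fin d))) ∂(uniformSphere d) ≤
      Real.exp (‖x‖ ^ 2 / (2 * d)) := by
  have h : HasSum (fun k : ℕ => (‖x‖ ^ 2 / (2 * d)) ^ k / k.factorial)
      (Real.exp (‖x‖ ^ 2 / (2 * d))) := by
    rw [Real.exp_eq_exp_ℝ]
    exact NormedSpace.expSeries_div_hasSum_exp _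
  exact hasSum_le (fun k => (sphereCoeff_bounds x k).1) (hasSum_sphereCoeff x) h

/-- Summing the coefficientwise lower bounds, the correction is `(1/d) ∑ k (k - 1) t ^ k / k! = (t²
/ d) exp t`. -/
theorem le_integral_exp_inner (x : EuclideanSpace ℝ (Fin d)) :
    (1 - (‖x‖ ^ 2 / (2 * d)) ^ 2 / d) * Real.exp (‖x‖ ^ 2 / (2 * d)) ≤
      ∫ c, Real.exp (inner ℝ x (c : EuclideanSpace ℝ (Fin d))) ∂(uniformSphere d) := by
  set t := ‖x‖ ^ 2 / (2 * d)
  have h : HasSum (fun k : ℕ => t ^ k / k.factorial) (Real.exp t) := by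
    rw [Real.exp_eq_exp_ℝ]
    exact NormedSpace.expSeries_div_hasSum_exp _
  have h2 : HasSum (fun k : ℕ => (k : ℝ) * (k - 1) * (t ^ k / k.factorial))
      (t ^ 2 * Real.exp t) := by
    rw [← hasSum_nat_add_iff' 2]
    have he : (fun k : ℕ => ((k + 2 : ℕ) : ℝ) * ((k + 2 : ℕ) - 1) *
        (t ^ (k + 2) / (k + 2).factorial)) = fun k : ℕ => t ^ 2 * (t ^ k / k.factorial) := by
      funext k
      rw [Nat.factorial_succ, Nat.factorial_succ]
      push_cast
      field_simp
      ring
    have hr : ∑ k ∈ Finset.range 2, (k : ℝ) * (k - 1) * (t ^ k / k.factorial) = 0 := by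
      simp [Finset.sum_range_succ]
    rw [he, hr, sub_zero]
    exact h.mul_left (t ^ 2)
  have h3 := h.sub (h2.mul_left (1 / (d : ℝ)))
  refine le_of_eq_of_le (by ring) (hasSum_le (fun k => ?_) h3 (hasSum_sphereCoeff x))
  refine le_of_eq_of_le (by ring) (sphereCoeff_bounds x k).2

theorem one_le_integral_exp_inner (x : EuclideanSpace ℝ (Fin d)) :
    1 ≤ ∫ c, Real.exp (inner ℝ x (c : EuclideanSpace ℝ (Fin d))) ∂(uniformSphere d) := by
  calc (1 : ℝ) = ∫ c, (inner ℝ x (c : EuclideanSpace ℝ (Fin d)) + 1) ∂(uniformSphere d) := by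
        rw [integral_add (integrable_uniformSphere (by fun_prop)) (integrable_const _),
          uniformSphere_moment_one]
        simp
    _ ≤ _ := integral_mono (integrable_uniformSphere (by fun_prop))
        (integrable_uniformSphere (by fun_prop)) fun c => Real.add_one_le_exp _

end SphereMgf

/-! ### A priori bounds for log-linear means, without concentration -/

section LogLinear

variable {n d : ℕ}

/-- `E [exp ⟪x, c⟫ / (Z_c ^ i * Z'_c ^ j)]` for a uniform discourse vector `c` and the partition
functions `Z`, `Z'` of two families of vectors `v`, `u`. -/
def logLinearMean (v u : Fin n → EuclideanSpace ℝ (Fin d)) (i j : ℕ)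
    (x : EuclideanSpace ℝ (Fin d)) : ℝ :=
  ∫ c, Real.exp (inner ℝ x (c : EuclideanSpace ℝ (Fin d))) /
    (partitionFn v c ^ i * partitionFn u c ^ j) ∂(uniformSphere d)

theorem continuous_partitionFn (v : Fin n → EuclideanSpace ℝ (Fin d)) :
    Continuous (partitionFn v) := by
  unfold partitionFn
  fun_prop

theorem partitionFn_pos [NeZero n] (v : Fin n → EuclideanSpace ℝ (Fin d)) (c : Discourse d) :
    0 < partitionFn v c :=
  Finset.sum_pos (fun _ _ => Real.exp_pos _) Finset.univ_nonempty

theorem continuous_logLinear [NeZero n] (v u : Fin n → EuclideanSpace ℝ (Fin d)) (i j : ℕ)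
    (x : EuclideanSpace ℝ (Fin d)) :
    Continuous fun c : Discourse d => Real.exp (inner ℝ x (c : EuclideanSpace ℝ (Fin d))) /
      (partitionFn v c ^ i * partitionFn u c ^ j) := by
  refine Continuous.div (by fun_prop)
    (((continuous_partitionFn v).pow i).mul ((continuous_partitionFn u).pow j)) fun c => ?_
  have := partitionFn_pos v c
  have := partitionFn_pos u c
  positivity

/-- The average of a family of vectors. -/
def meanVec (v : Fin n → EuclideanSpace ℝ (Fin d)) : EuclideanSpace ℝ (Fin d) :=
  (n : ℝ)⁻¹ • ∑ w, v w

theorem norm_meanVec_le [NeZero n] {v : Fin n → EuclideanSpace ℝ (Fin d)} {r : ℝ}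
    (hv : ∀ w, ‖v w‖ ≤ r) : ‖meanVec v‖ ≤ r := by
  have hn : (0 : ℝ) < n := Nat.cast_pos.2 (NeZero.pos n)
  rw [meanVec, norm_smul, norm_inv, Real.norm_natCast, inv_mul_le_iff₀ hn]
  calc ‖∑ w, v w‖ ≤ ∑ w : Fin n, r := norm_sum_le_of_le _ fun w _ => hv w
    _ = n * r := by simp

/-- Jensen's inequality, through the tangent line of `exp` at the mean exponent. It makes `1 / Z_c`
at most a single exponential of a linear form, so the spherical bounds apply to quotients as well.
-/
theorem card_mul_exp_meanVec_le [NeZero n] (v : Fin n → EuclideanSpace ℝ (Fin d))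
    (c : Discourse d) :
    n * Real.exp (inner ℝ (meanVec v) (c : EuclideanSpace ℝ (Fin d))) ≤ partitionFn v c := by
  have hn : (n : ℝ) ≠ 0 := Nat.cast_ne_zero.2 (NeZero.ne n)
  set m : ℝ := inner ℝ (meanVec v) (c : EuclideanSpace ℝ (Fin d)) with hm
  have hs : ∑ w, (inner ℝ (v w) (c : EuclideanSpace ℝ (Fin d)) : ℝ) = n * m := by
    rw [hm, meanVec, real_inner_smul_left, sum_inner, mul_inv_cancel_left₀ hn]
  calc n * Real.exp m
      = ∑ w, Real.exp m * (inner ℝ (v w) (c : EuclideanSpace ℝ (Fin d)) - m + 1) := by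
        rw [← Finset.mul_sum, Finset.sum_add_distrib, Finset.sum_sub_distrib, hs]
        simp
        ring
    _ ≤ partitionFn v c := by
        refine Finset.sum_le_sum fun w _ => ?_
        calc _ ≤ Real.exp m * Real.exp (inner ℝ (v w) (c : EuclideanSpace ℝ (Fin d)) - m) := by
              gcongr
              exact Real.add_one_le_exp _
          _ = _ := by rw [← Real.exp_add]; ring_nf

theorem logLinear_le_exp [NeZero n] (v u : Fin n → EuclideanSpace ℝ (Fin d)) (i j : ℕ)
    (x : EuclideanSpace ℝ (Fin d)) (c : Discourse d) :
    Real.exp (inner ℝ x (c : EuclideanSpace ℝ (Fin d))) /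
        (partitionFn v c ^ i * partitionFn u c ^ j) ≤
      ((n : ℝ) ^ (i + j))⁻¹ * Real.exp (inner ℝ (x - (i : ℝ) • meanVec v - (j : ℝ) • meanVec u)
        (c : EuclideanSpace ℝ (Fin d))) := by
  have hn : (0 : ℝ) < n := Nat.cast_pos.2 (NeZero.pos n)
  have h1 := card_mul_exp_meanVec_le v c
  have h2 := card_mul_exp_meanVec_le u c
  calc _ ≤ Real.exp (inner ℝ x (c : EuclideanSpace ℝ (Fin d))) /
        ((n * Real.exp (inner ℝ (meanVec v) (c : EuclideanSpace ℝ (Fin d)))) ^ i *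
          (n * Real.exp (inner ℝ (meanVec u) (c : EuclideanSpace ℝ (Fin d)))) ^ j) := by
        have := partitionFn_pos v c
        gcongr
    _ = _ := by
        rw [inner_sub_left, inner_sub_left, real_inner_smul_left, real_inner_smul_left,
          Real.exp_sub, Real.exp_sub, Real.exp_nat_mul, Real.exp_nat_mul, mul_pow, mul_pow, pow_add]
        field_simp

theorem integral_exp_inner_le_of_norm_le [NeZero d] {x : EuclideanSpace ℝ (Fin d)} {r : ℝ}
    (hx : ‖x‖ ≤ r * √d) :
    ∫ c, Real.exp (inner ℝ x (c : EuclideanSpace ℝ (Fin d))) ∂(uniformSphere d) ≤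
      Real.exp (r ^ 2 / 2) := by
  have hd : (0 : ℝ) < d := Nat.cast_pos.2 (NeZero.pos d)
  refine (integral_exp_inner_le x).trans (Real.exp_le_exp.2 ?_)
  rw [div_le_div_iff₀ (by positivity) (by norm_num)]
  have : ‖x‖ ^ 2 ≤ r ^ 2 * d := by
    calc ‖x‖ ^ 2 ≤ (r * √d) ^ 2 := by gcongr
      _ = r ^ 2 * d := by rw [mul_pow, Real.sq_sqrt hd.le]
  linarith

theorem norm_shift_le [NeZero n] {v u : Fin n → EuclideanSpace ℝ (Fin d)} {i j : ℕ}
    {x : EuclideanSpace ℝ (Fin d)} {R : ℝ} (hij : i + j ≤ 3)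
    (hv : ∀ w, ‖v w‖ ≤ R * √d) (hu : ∀ w, ‖u w‖ ≤ R * √d) (hx : ‖x‖ ≤ 3 * R * √d) :
    ‖x - (i : ℝ) • meanVec v - (j : ℝ) • meanVec u‖ ≤ 6 * R * √d := by
  have h1 := norm_meanVec_le hv
  have h2 := norm_meanVec_le hu
  have h0 : 0 ≤ R * √d := (norm_nonneg _).trans h1
  have hij' : (i : ℝ) + j ≤ 3 := by exact_mod_cast hij
  calc _ ≤ ‖x‖ + i * ‖meanVec v‖ + j * ‖meanVec u‖ := by
        refine (norm_sub_le _ _).trans ?_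
        rw [norm_smul, Real.norm_natCast]
        gcongr
        refine (norm_sub_le _ _).trans ?_
        rw [norm_smul, Real.norm_natCast]
    _ ≤ 3 * R * √d + i * (R * √d) + j * (R * √d) := by gcongr
    _ ≤ 6 * R * √d := by nlinarith

variable [NeZero n] [NeZero d]

theorem logLinearMean_le {v u : Fin n → EuclideanSpace ℝ (Fin d)} {i j : ℕ}
    {x : EuclideanSpace ℝ (Fin d)} {R : ℝ} (hij : i + j ≤ 3)
    (hv : ∀ w, ‖v w‖ ≤ R * √d) (hu : ∀ w, ‖u w‖ ≤ R * √d) (hx : ‖x‖ ≤ 3 * R * √d) :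
    logLinearMean v u i j x ≤ ((n : ℝ) ^ (i + j))⁻¹ * Real.exp (18 * R ^ 2) := by
  calc logLinearMean v u i j x ≤ ∫ c, ((n : ℝ) ^ (i + j))⁻¹ *
        Real.exp (inner ℝ (x - (i : ℝ) • meanVec v - (j : ℝ) • meanVec u)
        (c : EuclideanSpace ℝ (Fin d))) ∂(uniformSphere d) :=
        integral_mono (integrable_uniformSphere (continuous_logLinear v u i j x))
          (integrable_uniformSphere (by fun_prop)) (logLinear_le_exp v u i j x)
    _ ≤ ((n : ℝ) ^ (i + j))⁻¹ * Real.exp ((6 * R) ^ 2 / 2) := by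
        rw [integral_const_mul]
        gcongr
        exact integral_exp_inner_le_of_norm_le (norm_shift_le hij hv hu hx)
    _ = _ := by ring_nf

omit [NeZero n] in
theorem integral_partitionFn_le {v : Fin n → EuclideanSpace ℝ (Fin d)} {R : ℝ}
    (hv : ∀ w, ‖v w‖ ≤ R * √d) :
    ∫ c, partitionFn v c ∂(uniformSphere d) ≤ n * Real.exp (R ^ 2 / 2) := by
  unfold partitionFn
  rw [integral_finsetSum _ fun w _ => integrable_uniformSphere (by fun_prop)]
  calc _ ≤ ∑ w : Fin n, Real.exp (R ^ 2 / 2) :=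
        Finset.sum_le_sum fun w _ => integral_exp_inner_le_of_norm_le (hv w)
    _ = _ := by simp

/-- The integrand is bounded below by an expression affine in `⟪x, c⟫`, `Z_c` and `Z'_c`. Since `⟪x,
c⟫` has mean zero and `m` majorizes the means of both partition functions, the mean of that
expression is at least `m ^ -(i + j)`. -/
theorem le_logLinearMean {v u : Fin n → EuclideanSpace ℝ (Fin d)} {i j : ℕ}
    {x : EuclideanSpace ℝ (Fin d)} {R : ℝ} (hij : i + j ≤ 3)
    (hv : ∀ w, ‖v w‖ ≤ R * √d) (hu : ∀ w, ‖u w‖ ≤ R * √d) :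
    ((n : ℝ) ^ (i + j))⁻¹ * Real.exp (-(18 * R ^ 2)) ≤ logLinearMean v u i j x := by
  have hn : (0 : ℝ) < n := Nat.cast_pos.2 (NeZero.pos n)
  set m : ℝ := n * Real.exp (R ^ 2 / 2) with hm
  have hm0 : 0 < m := by positivity
  have hpt : ∀ c : Discourse d, (m ^ (i + j))⁻¹ *
      (1 + (inner ℝ x (c : EuclideanSpace ℝ (Fin d)) + i * (1 - partitionFn v c / m) +
        j * (1 - partitionFn u c / m))) ≤
      Real.exp (inner ℝ x (c : EuclideanSpace ℝ (Fin d))) /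
        (partitionFn v c ^ i * partitionFn u c ^ j) := by
    intro c
    -- This is `log (Z_c / m) ≤ Z_c / m - 1`, exponentiated and raised to the power `-i`.
    have key : ∀ (v : Fin n → EuclideanSpace ℝ (Fin d)) (i : ℕ),
        (m ^ i)⁻¹ * Real.exp (i * (1 - partitionFn v c / m)) ≤ (partitionFn v c ^ i)⁻¹ := by
      intro v i
      have hz := partitionFn_pos v c
      rw [Real.exp_nat_mul, ← inv_pow, ← inv_pow, ← mul_pow]
      gcongr
      have h := Real.add_one_le_exp (-(1 - partitionFn v c / m))
      rw [Real.exp_neg] at h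
      have h2 : partitionFn v c / m ≤ (Real.exp (1 - partitionFn v c / m))⁻¹ := by linarith
      rw [le_inv_comm₀ (by positivity) (by positivity), inv_div] at h2
      calc m⁻¹ * Real.exp (1 - partitionFn v c / m) ≤ m⁻¹ * (m / partitionFn v c) := by gcongr
        _ = _ := by field_simp
    calc _ ≤ (m ^ (i + j))⁻¹ * Real.exp (inner ℝ x (c : EuclideanSpace ℝ (Fin d)) +
          i * (1 - partitionFn v c / m) + j * (1 - partitionFn u c / m)) := by
          gcongr
          linarith [Real.add_one_le_exp (inner ℝ x (c : EuclideanSpace ℝ (Fin d)) +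
            i * (1 - partitionFn v c / m) + j * (1 - partitionFn u c / m))]
      _ = Real.exp (inner ℝ x (c : EuclideanSpace ℝ (Fin d))) *
          (((m ^ i)⁻¹ * Real.exp (i * (1 - partitionFn v c / m))) *
            ((m ^ j)⁻¹ * Real.exp (j * (1 - partitionFn u c / m)))) := by
          rw [Real.exp_add, Real.exp_add, pow_add, mul_inv]
          ring
      _ ≤ Real.exp (inner ℝ x (c : EuclideanSpace ℝ (Fin d))) *
          ((partitionFn v c ^ i)⁻¹ * (partitionFn u c ^ j)⁻¹) := by
          gcongr
          · exact inv_nonneg.2 (pow_nonneg (partitionFn_pos v c).le _)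
          · exact key v i
          · exact key u j
      _ = _ := by rw [div_eq_mul_inv, mul_inv]
  have hcv := continuous_partitionFn v
  have hcu := continuous_partitionFn u
  have hint := integral_mono (μ := uniformSphere d) (integrable_uniformSphere (by fun_prop))
    (integrable_uniformSphere (continuous_logLinear v u i j x)) hpt
  have hv' : (∫ c, partitionFn v c ∂(uniformSphere d)) / m ≤ 1 := by
    rw [div_le_one hm0]
    exact integral_partitionFn_le hv
  have hu' : (∫ c, partitionFn u c ∂(uniformSphere d)) / m ≤ 1 := by
    rw [div_le_one hm0]
    exact integral_partitionFn_le hu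
  have hcalc : (m ^ (i + j))⁻¹ ≤ ∫ c, (m ^ (i + j))⁻¹ *
      (1 + (inner ℝ x (c : EuclideanSpace ℝ (Fin d)) + i * (1 - partitionFn v c / m) +
        j * (1 - partitionFn u c / m))) ∂(uniformSphere d) := by
    rw [integral_const_mul, integral_add (integrable_const _)
      (integrable_uniformSphere (by fun_prop)), integral_add
      (integrable_uniformSphere (by fun_prop)) (integrable_uniformSphere (by fun_prop)),
      integral_add (integrable_uniformSphere (by fun_prop))
      (integrable_uniformSphere (by fun_prop)), uniformSphere_moment_one, integral_const_mul,
      integral_const_mul, integral_sub (integrable_const _)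
      (integrable_uniformSphere (by fun_prop)), integral_sub (integrable_const _)
      (integrable_uniformSphere (by fun_prop)), integral_div, integral_div]
    simp only [integral_const, probReal_univ, smul_eq_mul, mul_one]
    refine le_mul_of_one_le_right (by positivity) ?_
    have h1 := mul_nonneg (Nat.cast_nonneg (α := ℝ) i) (sub_nonneg.2 hv')
    have h2 := mul_nonneg (Nat.cast_nonneg (α := ℝ) j) (sub_nonneg.2 hu')
    linarith
  refine le_trans ?_ (hcalc.trans hint)
  rw [hm, mul_pow, mul_inv]
  gcongr
  rw [← Real.exp_nat_mul, ← Real.exp_neg, Real.exp_le_exp]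
  have hij' : ((i + j : ℕ) : ℝ) ≤ 3 := by exact_mod_cast hij
  nlinarith [sq_nonneg R]

theorem logLinearMean_pos {v u : Fin n → EuclideanSpace ℝ (Fin d)} {i j : ℕ}
    {x : EuclideanSpace ℝ (Fin d)} {R : ℝ} (hij : i + j ≤ 3)
    (hv : ∀ w, ‖v w‖ ≤ R * √d) (hu : ∀ w, ‖u w‖ ≤ R * √d) :
    0 < logLinearMean v u i j x := by
  have hn : (0 : ℝ) < n := Nat.cast_pos.2 (NeZero.pos n)
  exact lt_of_lt_of_le (by positivity) (le_logLinearMean hij hv hu)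

theorem abs_log_logLinearMean_add_le {v u : Fin n → EuclideanSpace ℝ (Fin d)} {i j : ℕ}
    {x : EuclideanSpace ℝ (Fin d)} {R : ℝ} (hij : i + j ≤ 3)
    (hv : ∀ w, ‖v w‖ ≤ R * √d) (hu : ∀ w, ‖u w‖ ≤ R * √d) (hx : ‖x‖ ≤ 3 * R * √d) :
    |Real.log (logLinearMean v u i j x) + ((i : ℝ) + j) * Real.log n| ≤ 18 * R ^ 2 := by
  have hn : (0 : ℝ) < n := Nat.cast_pos.2 (NeZero.pos n)
  have hpos := logLinearMean_pos (x := x) hij hv hu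
  have h1 := Real.log_le_log (by positivity) (le_logLinearMean (x := x) hij hv hu)
  have h2 := Real.log_le_log hpos (logLinearMean_le hij hv hu hx)
  rw [Real.log_mul (by positivity) (by positivity), Real.log_exp, Real.log_inv,
    Real.log_pow] at h1 h2
  push_cast at h1 h2
  rw [abs_le]
  constructor <;> linarith

/-- A weighted form of Cauchy-Schwarz: integrate `e ≤ (s/2) e² + 1/(2s)` over `S`. The square `e² =
exp ⟪2y, c⟫` has bounded mean, and a measure of `s²` offsets the factor `1/(2s)`. -/
theorem setIntegral_exp_inner_le {y : EuclideanSpace ℝ (Fin d)} {S : Set (Discourse d)}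
    {s r : ℝ} (hs : 0 < s) (hμ : (uniformSphere d).real S ≤ s ^ 2)
    (hy : ‖y‖ ≤ r * √d) :
    ∫ c in S, Real.exp (inner ℝ y (c : EuclideanSpace ℝ (Fin d))) ∂(uniformSphere d) ≤
      s * Real.exp (2 * r ^ 2) := by
  have hpt : ∀ c : Discourse d, Real.exp (inner ℝ y (c : EuclideanSpace ℝ (Fin d))) ≤
      s / 2 * Real.exp (inner ℝ ((2 : ℝ) • y) (c : EuclideanSpace ℝ (Fin d))) + (2 * s)⁻¹ := by
    intro c
    rw [real_inner_smul_left, two_mul, Real.exp_add]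
    set e := Real.exp (inner ℝ y (c : EuclideanSpace ℝ (Fin d)))
    have h : s / 2 * (e * e) + (2 * s)⁻¹ - e = (s * e - 1) ^ 2 / (2 * s) := by
      field_simp
      ring
    have : 0 ≤ (s * e - 1) ^ 2 / (2 * s) := by positivity
    linarith
  have h2y : ‖(2 : ℝ) • y‖ ≤ (2 * r) * √d := by
    rw [norm_smul, Real.norm_ofNat]
    linarith
  have hI := integral_exp_inner_le_of_norm_le h2y
  have hi1 : Integrable (fun c : Discourse d => s / 2 *
      Real.exp (inner ℝ ((2 : ℝ) • y) (c : EuclideanSpace ℝ (Fin d)))) (uniformSphere d) :=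
    integrable_uniformSphere (by fun_prop)
  calc _ ≤ ∫ c in S, (s / 2 * Real.exp (inner ℝ ((2 : ℝ) • y) (c : EuclideanSpace ℝ (Fin d))) +
        (2 * s)⁻¹) ∂(uniformSphere d) :=
        integral_mono (integrable_uniformSphere (by fun_prop)).integrableOn
          (integrable_uniformSphere (by fun_prop)).integrableOn hpt
    _ = (∫ c in S, s / 2 * Real.exp (inner ℝ ((2 : ℝ) • y) (c : EuclideanSpace ℝ (Fin d)))
        ∂(uniformSphere d)) + (uniformSphere d).real S * (2 * s)⁻¹ := by
        rw [integral_add hi1.integrableOn (integrable_const _), setIntegral_const, smul_eq_mul]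
    _ ≤ s / 2 * Real.exp (2 * r ^ 2) + s ^ 2 * (2 * s)⁻¹ := by
        gcongr
        refine (setIntegral_le_integral hi1 (.of_forall fun c => by positivity)).trans ?_
        rw [integral_const_mul]
        gcongr
        refine hI.trans_eq ?_
        ring_nf
    _ = s / 2 * Real.exp (2 * r ^ 2) + s / 2 := by
        congr 1
        field_simp
    _ ≤ _ := by
        have := Real.one_le_exp (show 0 ≤ 2 * r ^ 2 by positivity)
        nlinarith

end LogLinear

/-! ### From relative errors to exponential factors -/

theorem exp_neg_two_mul_le_one_sub {t : ℝ} (h0 : 0 ≤ t) (h1 : t ≤ 1 / 2) :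
    Real.exp (-(2 * t)) ≤ 1 - t := by
  rw [Real.exp_neg]
  refine inv_le_of_inv_le₀ (by linarith) ?_
  rw [inv_le_iff_one_le_mul₀ (by linarith)]
  have := Real.add_one_le_exp (2 * t)
  nlinarith

theorem pow_bounds_of_relative_error {z Z ε : ℝ} (i : ℕ) (hZ : 0 < Z) (h0 : 0 ≤ ε)
    (h1 : ε ≤ 1 / 2) (hl : (1 - ε) * Z ≤ z) (hu : z ≤ (1 + ε) * Z) :
    Real.exp (-(2 * (i * ε))) * Z ^ i ≤ z ^ i ∧ z ^ i ≤ Real.exp (2 * (i * ε)) * Z ^ i := by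
  have e1 : Real.exp (-(2 * (i * ε))) = Real.exp (-(2 * ε)) ^ i := by
    rw [← Real.exp_nat_mul]; ring_nf
  have e2 : Real.exp (2 * (i * ε)) = Real.exp (2 * ε) ^ i := by
    rw [← Real.exp_nat_mul]; ring_nf
  have hz : 0 ≤ z := le_trans (mul_nonneg (by linarith) hZ.le) hl
  rw [e1, e2, ← mul_pow, ← mul_pow]
  constructor
  · gcongr
    exact (mul_le_mul_of_nonneg_right (exp_neg_two_mul_le_one_sub h0 h1) hZ.le).trans hl
  · gcongr
    refine hu.trans (mul_le_mul_of_nonneg_right ?_ hZ.le)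
    linarith [Real.add_one_le_exp (2 * ε)]

/-! ### Log-linear means under concentration of the partition functions -/

section Concentration

variable {n d : ℕ} [NeZero n] [NeZero d]

theorem abs_log_integral_exp_inner_sub_le {x : EuclideanSpace ℝ (Fin d)} {R : ℝ}
    (hx : ‖x‖ ≤ 3 * R * √d) (hd : 21 * R ^ 4 / d ≤ 1 / 2) :
    |Real.log (∫ c, Real.exp (inner ℝ x (c : EuclideanSpace ℝ (Fin d))) ∂(uniformSphere d)) -
      ‖x‖ ^ 2 / (2 * d)| ≤ 42 * R ^ 4 / d := by
  have hd0 : (0 : ℝ) < d := Nat.cast_pos.2 (NeZero.pos d)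
  have h1 := integral_exp_inner_le x
  have h2 := le_integral_exp_inner x
  have h3 := one_le_integral_exp_inner x
  set E := ∫ c, Real.exp (inner ℝ x (c : EuclideanSpace ℝ (Fin d))) ∂(uniformSphere d)
  set t := ‖x‖ ^ 2 / (2 * d) with ht
  have ht0 : 0 ≤ t := by positivity
  have ht1 : t ≤ 9 / 2 * R ^ 2 := by
    rw [ht, div_le_iff₀ (by positivity)]
    calc ‖x‖ ^ 2 ≤ (3 * R * √d) ^ 2 := by gcongr
      _ = 9 / 2 * R ^ 2 * (2 * d) := by rw [mul_pow, Real.sq_sqrt hd0.le]; ring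
  have ht2 : t ^ 2 / d ≤ 21 * R ^ 4 / d := by
    gcongr
    nlinarith [sq_nonneg (R ^ 2)]
  have ht3 : 0 ≤ t ^ 2 / d := by positivity
  have h4 := exp_neg_two_mul_le_one_sub ht3 (ht2.trans hd)
  have h5 : Real.exp (-(2 * (t ^ 2 / d)) + t) ≤ E := by
    rw [Real.exp_add]
    exact (mul_le_mul_of_nonneg_right h4 (Real.exp_pos _).le).trans h2
  have hE : 0 < E := by linarith
  have h6 : Real.log E ≤ t := (Real.log_le_iff_le_exp hE).2 h1
  have h7 : -(2 * (t ^ 2 / d)) + t ≤ Real.log E := (Real.le_log_iff_exp_le hE).2 h5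
  have h8 : 42 * R ^ 4 / d = 2 * (21 * R ^ 4 / d) := by ring
  rw [abs_le]
  constructor <;> linarith

/-- On `G` the denominator is `Z ^ i * Z' ^ j` up to a factor `exp (±θ)`. Off `G` both `exp ⟪x, c⟫`
and the quotient carry at most a fraction `κ` of their total integrals. Here `90 = 72 + 18`: `72 R²`
comes from the bad-set bound for a shifted vector of norm `6R√d`, and `18 R²` from the a priori
lower bound. -/
theorem abs_log_logLinearMean_sub_le {v u : Fin n → EuclideanSpace ℝ (Fin d)} {i j : ℕ}
    {x : EuclideanSpace ℝ (Fin d)} {R Z Z' ε ε' s : ℝ} {G : Set (Discourse d)} (hij : i + j ≤ 3)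
    (hv : ∀ w, ‖v w‖ ≤ R * √d) (hu : ∀ w, ‖u w‖ ≤ R * √d) (hx : ‖x‖ ≤ 3 * R * √d)
    (hZ : 0 < Z) (hZ' : 0 < Z') (hε : 0 ≤ ε) (hε1 : ε ≤ 1 / 2) (hε' : 0 ≤ ε') (hε1' : ε' ≤ 1 / 2)
    (hG : MeasurableSet G) (hs : 0 < s) (hμ : (uniformSphere d).real Gᶜ ≤ s ^ 2)
    (hGv : ∀ c ∈ G, (1 - ε) * Z ≤ partitionFn v c ∧ partitionFn v c ≤ (1 + ε) * Z)
    (hGu : ∀ c ∈ G, (1 - ε') * Z' ≤ partitionFn u c ∧ partitionFn u c ≤ (1 + ε') * Z')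
    (hsmall : s * Real.exp (90 * R ^ 2) ≤ 1 / 2) (hd : 21 * R ^ 4 / d ≤ 1 / 2) :
    |Real.log (logLinearMean v u i j x) -
        (‖x‖ ^ 2 / (2 * d) - i * Real.log Z - j * Real.log Z')| ≤
      6 * (ε + ε') + 2 * (s * Real.exp (90 * R ^ 2)) + 42 * R ^ 4 / d := by
  have hn : (0 : ℝ) < n := Nat.cast_pos.2 (NeZero.pos n)
  have hE := abs_log_integral_exp_inner_sub_le hx hd
  have hE1 := one_le_integral_exp_inner x
  have hQ := logLinearMean_pos (x := x) hij hv hu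
  have hQlow := le_logLinearMean (x := x) hij hv hu
  set κ := s * Real.exp (90 * R ^ 2) with hκ
  have hκ0 : 0 ≤ κ := by positivity
  set θ := 2 * (i * ε) + 2 * (j * ε') with hθ
  set D := Z ^ i * Z' ^ j with hD
  have hD0 : 0 < D := by positivity
  set f : Discourse d → ℝ := fun c => Real.exp (inner ℝ x (c : EuclideanSpace ℝ (Fin d))) with hf
  set g : Discourse d → ℝ := fun c => f c / (partitionFn v c ^ i * partitionFn u c ^ j) with hg
  have hfi : Integrable f (uniformSphere d) := integrable_uniformSphere (by fun_prop)
  have hgi : Integrable g (uniformSphere d) :=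
    integrable_uniformSphere (continuous_logLinear v u i j x)
  have hQdef : logLinearMean v u i j x = ∫ c, g c ∂(uniformSphere d) := rfl
  set Q := logLinearMean v u i j x
  set E := ∫ c, f c ∂(uniformSphere d)
  have hE0 : 0 < E := by linarith
  have hden : ∀ c ∈ G, Real.exp (-θ) * D ≤ partitionFn v c ^ i * partitionFn u c ^ j ∧
      partitionFn v c ^ i * partitionFn u c ^ j ≤ Real.exp θ * D := by
    intro c hc
    obtain ⟨h1, h2⟩ := pow_bounds_of_relative_error i hZ hε hε1 (hGv c hc).1 (hGv c hc).2
    obtain ⟨h3, h4⟩ := pow_bounds_of_relative_error j hZ' hε' hε1' (hGu c hc).1 (hGu c hc).2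
    have hp1 := partitionFn_pos v c
    have hp2 := partitionFn_pos u c
    constructor
    · calc Real.exp (-θ) * D = (Real.exp (-(2 * (i * ε))) * Z ^ i) *
            (Real.exp (-(2 * (j * ε'))) * Z' ^ j) := by
            rw [hθ, neg_add, Real.exp_add, hD]; ring
        _ ≤ _ := by gcongr
    · calc _ ≤ (Real.exp (2 * (i * ε)) * Z ^ i) * (Real.exp (2 * (j * ε')) * Z' ^ j) := by gcongr
        _ = _ := by rw [hθ, Real.exp_add, hD]; ring
  have hbadg : ∫ c in Gᶜ, g c ∂(uniformSphere d) ≤ κ * Q := by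
    have h1 := setIntegral_exp_inner_le hs hμ (norm_shift_le hij hv hu hx)
    calc ∫ c in Gᶜ, g c ∂(uniformSphere d) ≤ ∫ c in Gᶜ, ((n : ℝ) ^ (i + j))⁻¹ *
          Real.exp (inner ℝ (x - (i : ℝ) • meanVec v - (j : ℝ) • meanVec u)
          (c : EuclideanSpace ℝ (Fin d))) ∂(uniformSphere d) :=
          integral_mono hgi.integrableOn (integrable_uniformSphere (by fun_prop)).integrableOn
            (logLinear_le_exp v u i j x)
      _ ≤ ((n : ℝ) ^ (i + j))⁻¹ * (s * Real.exp (2 * (6 * R) ^ 2)) := by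
          rw [integral_const_mul]
          gcongr
      _ = κ * (((n : ℝ) ^ (i + j))⁻¹ * Real.exp (-(18 * R ^ 2))) := by
          have : Real.exp (2 * (6 * R) ^ 2) =
              Real.exp (90 * R ^ 2) * Real.exp (-(18 * R ^ 2)) := by
            rw [← Real.exp_add]; ring_nf
          rw [hκ, this]
          ring
      _ ≤ κ * Q := by gcongr
  -- `E ≥ 1` turns the absolute bound into a relative one.
  have hbadf : ∫ c in Gᶜ, f c ∂(uniformSphere d) ≤ κ * E := by
    have h1 := setIntegral_exp_inner_le hs hμ hx
    calc _ ≤ s * Real.exp (2 * (3 * R) ^ 2) := h1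
      _ ≤ κ * 1 := by
          rw [mul_one, hκ]
          exact mul_le_mul_of_nonneg_left
            (Real.exp_le_exp.2 (by nlinarith [sq_nonneg R])) hs.le
      _ ≤ κ * E := by gcongr
  have hgood1 : ∫ c in G, g c ∂(uniformSphere d) ≤ Real.exp θ / D * E := by
    calc ∫ c in G, g c ∂(uniformSphere d) ≤ ∫ c in G, Real.exp θ / D * f c ∂(uniformSphere d) := by
          refine setIntegral_mono_on hgi.integrableOn (hfi.const_mul _).integrableOn hG
            fun c hc => ?_
          calc g c ≤ f c / (Real.exp (-θ) * D) := by
                have := (hden c hc).1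
                simp only [hg]
                gcongr
            _ = Real.exp θ / D * f c := by
                rw [Real.exp_neg]
                field_simp
      _ ≤ Real.exp θ / D * E := by
          rw [integral_const_mul]
          gcongr
          exact setIntegral_le_integral hfi (.of_forall fun c => (Real.exp_pos _).le)
  have hgood2 : Real.exp (-θ) / D * ∫ c in G, f c ∂(uniformSphere d) ≤
      ∫ c in G, g c ∂(uniformSphere d) := by
    rw [← integral_const_mul]
    refine setIntegral_mono_on (hfi.const_mul _).integrableOn hgi.integrableOn hG fun c hc => ?_
    have hp1 := partitionFn_pos v c
    have hp2 := partitionFn_pos u c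
    calc Real.exp (-θ) / D * f c = f c / (Real.exp θ * D) := by
          rw [Real.exp_neg]
          field_simp
      _ ≤ g c := by
          have := (hden c hc).2
          simp only [hg]
          gcongr
  have hsplitg := integral_add_compl hG hgi
  have hsplitf := integral_add_compl hG hfi
  have hnn : 0 ≤ ∫ c in Gᶜ, g c ∂(uniformSphere d) := by
    refine integral_nonneg fun c => ?_
    have hp1 := partitionFn_pos v c
    have hp2 := partitionFn_pos u c
    positivity
  have hκ1 := exp_neg_two_mul_le_one_sub hκ0 hsmall
  have hup : Real.exp (-(2 * κ)) * Q ≤ Real.exp θ / D * E := by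
    calc _ ≤ (1 - κ) * Q := by gcongr
      _ ≤ _ := by linarith
  have hlow : Real.exp (-θ) / D * (Real.exp (-(2 * κ)) * E) ≤ Q := by
    calc _ ≤ Real.exp (-θ) / D * ((1 - κ) * E) := by gcongr
      _ ≤ Real.exp (-θ) / D * ∫ c in G, f c ∂(uniformSphere d) := by
          gcongr
          linarith
      _ ≤ Q := by linarith
  have hlogD : Real.log D = i * Real.log Z + j * Real.log Z' := by
    rw [hD, Real.log_mul (by positivity) (by positivity), Real.log_pow, Real.log_pow]
  have hup' := Real.log_le_log (by positivity) hup
  have hlow' := Real.log_le_log (by positivity) hlow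
  rw [Real.log_mul (by positivity) (by positivity), Real.log_mul (by positivity) (by positivity),
    Real.log_div (by positivity) (by positivity), Real.log_exp, Real.log_exp, hlogD] at hup'
  rw [Real.log_mul (by positivity) (by positivity), Real.log_mul (by positivity) (by positivity),
    Real.log_div (by positivity) (by positivity), Real.log_exp, Real.log_exp, hlogD] at hlow'
  have hθ6 : θ ≤ 6 * (ε + ε') := by
    have hi : (i : ℝ) ≤ 3 := by exact_mod_cast (by omega : i ≤ 3)
    have hj : (j : ℝ) ≤ 3 := by exact_mod_cast (by omega : j ≤ 3)
    rw [hθ]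
    nlinarith
  rw [abs_le] at hE ⊢
  constructor <;> linarith [hE.1, hE.2]

end Concentration

/-! ### The probabilities of the model as integrals over discourse vectors -/

section Law

variable {n d : ℕ} [NeZero n]

/-- The vectors `v_w + T(v_a, v_w, ·)`, whose partition function is `Z_{c,a}`. -/
def composedVec (v : Fin n → EuclideanSpace ℝ (Fin d)) (T : Fin d → Fin d → Fin d → ℝ)
    (a w : Fin n) : EuclideanSpace ℝ (Fin d) :=
  v w + tensorVec T (v a) (v w)

omit [NeZero n] in
theorem inner_tensorVec (T : Fin d → Fin d → Fin d → ℝ) (x y z : EuclideanSpace ℝ (Fin d)) :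
    inner ℝ (tensorVec T x y) z = triApply T x y z := by
  simp only [tensorVec, triApply, PiLp.inner_apply, RCLike.inner_apply, conj_trivial,
    Finset.mul_sum]
  rw [Finset.sum_comm]
  refine Finset.sum_congr rfl fun i _ => ?_
  rw [Finset.sum_comm]
  refine Finset.sum_congr rfl fun j _ => Finset.sum_congr rfl fun k _ => ?_
  ring

omit [NeZero n] in
theorem inner_composedVec (v : Fin n → EuclideanSpace ℝ (Fin d)) (T : Fin d → Fin d → Fin d → ℝ)
    (a w : Fin n) (c : EuclideanSpace ℝ (Fin d)) :
    inner ℝ (composedVec v T a w) c = inner ℝ c (v w) + triApply T (v a) (v w) c := by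
  rw [composedVec, inner_add_left, inner_tensorVec, real_inner_comm]

omit [NeZero n] in
theorem partitionFn₂_eq (v : Fin n → EuclideanSpace ℝ (Fin d)) (T : Fin d → Fin d → Fin d → ℝ)
    (a : Fin n) : partitionFn₂ v T a = partitionFn (composedVec v T a) := by
  funext c
  simp only [partitionFn₂, partitionFn, inner_composedVec]

omit [NeZero n] in
theorem secondProb_eq (v : Fin n → EuclideanSpace ℝ (Fin d)) (T : Fin d → Fin d → Fin d → ℝ)
    (c : Discourse d) (a b : Fin n) :
    secondProb v T c a b = wordProb (composedVec v T a) c b := by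
  rw [secondProb, wordProb, inner_composedVec, partitionFn₂_eq]

theorem continuous_wordProb (v : Fin n → EuclideanSpace ℝ (Fin d)) (w : Fin n) :
    Continuous fun c => wordProb v c w :=
  Continuous.div (by fun_prop) (continuous_partitionFn v) fun c => (partitionFn_pos v c).ne'

theorem wordProb_pos (v : Fin n → EuclideanSpace ℝ (Fin d)) (c : Discourse d) (w : Fin n) :
    0 < wordProb v c w :=
  div_pos (Real.exp_pos _) (partitionFn_pos v c)

theorem sum_wordProb (v : Fin n → EuclideanSpace ℝ (Fin d)) (c : Discourse d) :
    ∑ w, wordProb v c w = 1 := by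
  simp only [wordProb]
  rw [← Finset.sum_div]
  exact div_self (partitionFn_pos v c).ne'

variable {psyn : ℝ} (v : Fin n → EuclideanSpace ℝ (Fin d)) (T : Fin d → Fin d → Fin d → ℝ)

theorem outputProb_nonneg (h0 : 0 ≤ psyn) (h1 : psyn ≤ 1) (c : Discourse d) (o : Output n) :
    0 ≤ outputProb psyn v T c o := by
  rcases o with w | ⟨a, b⟩
  · exact mul_nonneg (sub_nonneg.2 h1) (wordProb_pos v c w).le
  · refine mul_nonneg h0 (mul_nonneg (wordProb_pos v c a).le ?_)
    change 0 ≤ secondProb v T c a b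
    rw [secondProb_eq]
    exact (wordProb_pos _ c b).le

theorem continuous_outputProb (o : Output n) : Continuous fun c => outputProb psyn v T c o := by
  rcases o with w | ⟨a, b⟩
  · exact (continuous_wordProb v w).const_mul _
  · have h := ((continuous_wordProb v a).mul
      (continuous_wordProb (composedVec v T a) b)).const_mul psyn
    simp only [← secondProb_eq] at h
    exact h

theorem measurable_outputProb :
    Measurable (Function.uncurry fun (c : Discourse d) (o : Output n) =>
      ENNReal.ofReal (outputProb psyn v T c o)) :=
  measurable_from_prod_countable_left fun o =>
    (continuous_outputProb v T o).measurable.ennreal_ofReal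

theorem outputKernel_apply (c : Discourse d) (s : Finset (Output n)) :
    outputKernel psyn v T c s = ∑ o ∈ s, ENNReal.ofReal (outputProb psyn v T c o) := by
  rw [outputKernel, Kernel.withDensity_apply' _ (measurable_outputProb v T), Kernel.const_apply,
    lintegral_finset]
  simp

instance : IsSFiniteKernel (outputKernel psyn v T) :=
  Kernel.IsSFiniteKernel.withDensity _ fun _ _ => ENNReal.ofReal_ne_top

variable (walk : Kernel (Discourse d) (Discourse d))

theorem jointLaw_rect [NeZero d] [IsMarkovKernel walk] (h0 : 0 ≤ psyn) (h1 : psyn ≤ 1)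
    (s t : Finset (Output n)) :
    (jointLaw psyn walk v T).real (Prod.snd ⁻¹' ((s : Set (Output n)) ×ˢ (t : Set (Output n)))) =
      ∫ z, (∑ o ∈ s, outputProb psyn v T z.1 o) * (∑ o ∈ t, outputProb psyn v T z.2 o)
        ∂((uniformSphere d) ⊗ₘ walk) := by
  have hm : MeasurableSet ((Prod.snd : (Discourse d × Discourse d) × (Output n × Output n) → _) ⁻¹'
      ((s : Set (Output n)) ×ˢ (t : Set (Output n)))) :=
    measurable_snd (s.measurableSet.prod t.measurableSet)
  have hnn : ∀ (s : Finset (Output n)) (c : Discourse d), 0 ≤ ∑ o ∈ s, outputProb psyn v T c o :=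
    fun s c => Finset.sum_nonneg fun o _ => outputProb_nonneg v T h0 h1 c o
  have hc : ∀ s : Finset (Output n), Continuous fun c => ∑ o ∈ s, outputProb psyn v T c o :=
    fun s => continuous_finsetSum _ fun o _ => continuous_outputProb v T o
  rw [integral_eq_lintegral_of_nonneg_ae (.of_forall fun z => mul_nonneg (hnn _ _) (hnn _ _))
    (((hc s).measurable.comp measurable_fst).mul
      ((hc t).measurable.comp measurable_snd)).aestronglyMeasurable, Measure.real, jointLaw,
    Measure.compProd_apply hm]
  congr 1
  refine lintegral_congr fun z => ?_
  rw [← Set.preimage_comp, Kernel.parallelComp_apply]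
  change ((outputKernel psyn v T z.1).prod (outputKernel psyn v T z.2))
    ((s : Set (Output n)) ×ˢ (t : Set (Output n))) = _
  rw [Measure.prod_prod, outputKernel_apply, outputKernel_apply, ENNReal.ofReal_mul (hnn _ _),
    ENNReal.ofReal_sum_of_nonneg fun o _ => outputProb_nonneg v T h0 h1 _ o,
    ENNReal.ofReal_sum_of_nonneg fun o _ => outputProb_nonneg v T h0 h1 _ o]

/-- The probability, in the conditioned model, that the single word lies in `s` and the pair
lies in `t`. -/
theorem condLaw_real_eq [NeZero d] [IsMarkovKernel walk] (h0 : 0 < psyn) (h1 : psyn < 1)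
    (s : Finset (Fin n)) (t : Finset (Fin n × Fin n))
    {S : Set ((Discourse d × Discourse d) × (Output n × Output n))}
    (hS : ∀ x, (x.2.1.isLeft ∧ x.2.2.isRight ∧ x ∈ S) ↔
      (∃ w ∈ s, x.2.1 = Sum.inl w) ∧ ∃ q ∈ t, x.2.2 = Sum.inr q) :
    (condLaw psyn walk v T).real S =
      ∫ z, (∑ w ∈ s, wordProb v z.1 w) *
        (∑ q ∈ t, wordProb v z.2 q.1 * wordProb (composedVec v T q.1) z.2 q.2)
        ∂((uniformSphere d) ⊗ₘ walk) := by
  have hrect : ∀ (s : Finset (Fin n)) (t : Finset (Fin n × Fin n)),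
      (jointLaw psyn walk v T).real (Prod.snd ⁻¹' (((s.disjSum ∅ : Finset (Output n)) :
        Set (Output n)) ×ˢ (((∅ : Finset (Fin n)).disjSum t : Finset (Output n)) :
        Set (Output n)))) = (1 - psyn) * psyn * ∫ z, (∑ w ∈ s, wordProb v z.1 w) *
        (∑ q ∈ t, wordProb v z.2 q.1 * wordProb (composedVec v T q.1) z.2 q.2)
        ∂((uniformSphere d) ⊗ₘ walk) := by
    intro s t
    rw [jointLaw_rect v T walk h0.le h1.le, ← integral_const_mul]
    refine integral_congr_ae (.of_forall fun z => ?_)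
    simp only [Finset.sum_disjSum, Finset.sum_empty, outputProb,
      Sum.elim_inl, Sum.elim_inr, ← Finset.mul_sum, secondProb_eq]
    ring
  -- The conditioning event is itself a rectangle, of probability `(1 - psyn) * psyn`; the same
  -- factor occurs in every joint probability and cancels.
  have hE : {x : (Discourse d × Discourse d) × (Output n × Output n) |
      x.2.1.isLeft ∧ x.2.2.isRight} = Prod.snd ⁻¹'
        ((((Finset.univ : Finset (Fin n)).disjSum ∅ : Finset (Output n)) : Set (Output n)) ×ˢ
        (((∅ : Finset (Fin n)).disjSum Finset.univ : Finset (Output n)) : Set (Output n))) := by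
    ext ⟨z, o, o'⟩
    rcases o with w | q <;> rcases o' with w' | q' <;> simp
  have hES : {x : (Discourse d × Discourse d) × (Output n × Output n) |
      x.2.1.isLeft ∧ x.2.2.isRight} ∩ S = Prod.snd ⁻¹'
        (((s.disjSum ∅ : Finset (Output n)) : Set (Output n)) ×ˢ
        (((∅ : Finset (Fin n)).disjSum t : Finset (Output n)) : Set (Output n))) := by
    ext x
    have := hS x
    rw [Set.mem_inter_iff, Set.mem_ofPred_eq, and_assoc, this]
    obtain ⟨z, o, o'⟩ := x
    rcases o with w | q <;> rcases o' with w' | q' <;> simp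
  have hEm : MeasurableSet {x : (Discourse d × Discourse d) × (Output n × Output n) |
      x.2.1.isLeft ∧ x.2.2.isRight} := by
    rw [hE]
    exact measurable_snd ((Finset.measurableSet _).prod (Finset.measurableSet _))
  rw [condLaw, measureReal_def, cond_apply hEm, hES, ENNReal.toReal_mul, ENNReal.toReal_inv,
    ← measureReal_def, ← measureReal_def, hE, hrect, hrect]
  have h2 : ∀ z : Discourse d × Discourse d, (∑ w, wordProb v z.1 w) *
      (∑ q : Fin n × Fin n, wordProb v z.2 q.1 * wordProb (composedVec v T q.1) z.2 q.2) = 1 := by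
    intro z
    rw [sum_wordProb, one_mul, Fintype.sum_prod_type]
    simp_rw [← Finset.mul_sum, sum_wordProb, mul_one]
    exact sum_wordProb v z.2
  simp_rw [h2]
  simp only [integral_const, probReal_univ, smul_eq_mul, mul_one]
  have h3 : (1 - psyn) * psyn ≠ 0 := (mul_pos (by linarith) h0).ne'
  rw [inv_mul_cancel_left₀ h3]

theorem pTriple_eq [NeZero d] [IsMarkovKernel walk] (h0 : 0 < psyn) (h1 : psyn < 1)
    (w a b : Fin n) :
    pTriple psyn walk v T w a b = ∫ z, wordProb v z.1 w *
      (wordProb v z.2 a * wordProb (composedVec v T a) z.2 b) ∂((uniformSphere d) ⊗ₘ walk) := by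
  rw [pTriple, condLaw_real_eq v T walk h0 h1 {w} {(a, b)}]
  · simp
  · rintro ⟨z, o, o'⟩
    rcases o with w | q <;> rcases o' with w' | q' <;> simp [Output.root]

theorem pTwo_eq [NeZero d] [IsMarkovKernel walk] (h0 : 0 < psyn) (h1 : psyn < 1)
    (w a : Fin n) :
    pTwo psyn walk v T w a =
      ∫ z, wordProb v z.1 w * wordProb v z.2 a ∂((uniformSphere d) ⊗ₘ walk) := by
  rw [pTwo, condLaw_real_eq v T walk h0 h1 {w} ({a} ×ˢ Finset.univ)]
  · simp [← Finset.mul_sum, sum_wordProb]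
  · rintro ⟨z, o, o'⟩
    rcases o with w | q <;> rcases o' with w' | q' <;>
      simp [Output.root, Prod.exists, Prod.ext_iff, eq_comm]

/-- By stationarity `c_{t+1}` is again uniform, so quantities that involve only `c_{t+1}` do not see
the walk. -/
theorem integral_snd_compProd [NeZero d] (hw : walk.Invariant (uniformSphere d))
    [IsMarkovKernel walk] {f : Discourse d → ℝ} (hf : Continuous f) :
    ∫ z, f z.2 ∂((uniformSphere d) ⊗ₘ walk) = ∫ c, f c ∂(uniformSphere d) := by
  have h : ((uniformSphere d) ⊗ₘ walk).map Prod.snd = uniformSphere d := by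
    have := Measure.snd_compProd (uniformSphere d) walk
    rw [Measure.snd] at this
    rw [this]
    exact hw
  rw [← integral_map (φ := Prod.snd) measurable_snd.aemeasurable hf.aestronglyMeasurable, h]

theorem pPair_eq [NeZero d] [IsMarkovKernel walk] (hw : walk.Invariant (uniformSphere d))
    (h0 : 0 < psyn) (h1 : psyn < 1) (a b : Fin n) :
    pPair psyn walk v T a b = ∫ c, wordProb v c a * wordProb (composedVec v T a) c b
      ∂(uniformSphere d) := by
  rw [pPair, condLaw_real_eq v T walk h0 h1 Finset.univ {(a, b)}]
  · simp only [sum_wordProb, one_mul, Finset.sum_singleton]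
    exact integral_snd_compProd walk hw
      ((continuous_wordProb v a).mul (continuous_wordProb (composedVec v T a) b))
  · rintro ⟨z, o, o'⟩
    rcases o with w | q <;> rcases o' with w' | q' <;> simp

theorem pOne_eq [NeZero d] [IsMarkovKernel walk] (hw : walk.Invariant (uniformSphere d))
    (h0 : 0 < psyn) (h1 : psyn < 1) (a : Fin n) :
    pOne psyn walk v T a = ∫ c, wordProb v c a ∂(uniformSphere d) := by
  rw [pOne, condLaw_real_eq v T walk h0 h1 Finset.univ ({a} ×ˢ Finset.univ)]
  · simp only [sum_wordProb, one_mul, Finset.sum_product, ← Finset.mul_sum, Finset.sum_singleton,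
      mul_one]
    exact integral_snd_compProd walk hw (continuous_wordProb v a)
  · rintro ⟨z, o, o'⟩
    rcases o with w | q <;> rcases o' with w' | q' <;>
      simp [Output.root, Prod.exists, Prod.ext_iff, eq_comm]

end Law

/-! ### The effect of one step of the walk -/

section Walk

variable {n d : ℕ} [NeZero n] [NeZero d] {v : Fin n → EuclideanSpace ℝ (Fin d)}
  {walk : Kernel (Discourse d) (Discourse d)} {R εw : ℝ}

omit [NeZero n] [NeZero d] in
theorem ae_norm_sub_le (hw : IsDiscourseWalk εw walk) :
    ∀ᵐ z ∂((uniformSphere d) ⊗ₘ walk), ‖(z.2 : EuclideanSpace ℝ (Fin d)) - z.1‖ ≤ εw / √d := by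
  have := hw.markov
  refine Measure.ae_compProd_of_ae_ae ?_ (.of_forall hw.step)
  exact measurableSet_le (by fun_prop) measurable_const

omit [NeZero n] in
theorem IsDiscourseWalk.nonneg (hw : IsDiscourseWalk εw walk) : 0 ≤ εw := by
  have := hw.markov
  have hd : (0 : ℝ) < √d := Real.sqrt_pos.2 (Nat.cast_pos.2 (NeZero.pos d))
  obtain ⟨z, hz⟩ := (ae_norm_sub_le hw).exists
  have := (norm_nonneg _).trans hz
  simpa using (le_div_iff₀ hd).1 this

/-- Every exponent moves by at most `R√d * εw/√d = R εw`; the numerator and the partition function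
each contribute one factor `exp (R εw)`. -/
theorem wordProb_le_of_norm_sub_le (hv : ∀ a, ‖v a‖ ≤ R * √d) {c c' : Discourse d}
    (hc : ‖(c' : EuclideanSpace ℝ (Fin d)) - c‖ ≤ εw / √d) (w : Fin n) :
    wordProb v c w ≤ Real.exp (2 * R * εw) * wordProb v c' w := by
  have hd : (0 : ℝ) < √d := Real.sqrt_pos.2 (Nat.cast_pos.2 (NeZero.pos d))
  have key : ∀ a, |(inner ℝ (v a) (c' : EuclideanSpace ℝ (Fin d)) : ℝ) -
      inner ℝ (v a) (c : EuclideanSpace ℝ (Fin d))| ≤ R * εw := by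
    intro a
    rw [← inner_sub_right]
    have h0 : 0 ≤ R * √d := (norm_nonneg _).trans (hv a)
    calc _ ≤ ‖v a‖ * ‖(c' : EuclideanSpace ℝ (Fin d)) - c‖ := abs_real_inner_le_norm _ _
      _ ≤ R * √d * (εw / √d) := by
          gcongr
          exact hv a
      _ = R * εw := by field_simp
  have hZ : Real.exp (-(R * εw)) * partitionFn v c' ≤ partitionFn v c := by
    simp only [partitionFn, Finset.mul_sum]
    refine Finset.sum_le_sum fun a _ => ?_
    rw [← Real.exp_add, Real.exp_le_exp]
    linarith [(abs_le.1 (key a)).2]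
  have hN : Real.exp (inner ℝ (v w) (c : EuclideanSpace ℝ (Fin d))) ≤
      Real.exp (R * εw) * Real.exp (inner ℝ (v w) (c' : EuclideanSpace ℝ (Fin d))) := by
    rw [← Real.exp_add, Real.exp_le_exp]
    linarith [(abs_le.1 (key w)).1]
  have hp := partitionFn_pos v c'
  calc wordProb v c w ≤ (Real.exp (R * εw) *
        Real.exp (inner ℝ (v w) (c' : EuclideanSpace ℝ (Fin d)))) /
        (Real.exp (-(R * εw)) * partitionFn v c') := by
        rw [wordProb]
        gcongr
    _ = _ := by
        rw [wordProb, mul_assoc, two_mul, Real.exp_add, Real.exp_neg]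
        field_simp

/-- Moving the first factor from `c_t` to `c_{t+1}` costs `exp (±2Rεw)` and leaves a function of
`c_{t+1}` alone, which is uniform. -/
theorem abs_log_integral_walk_sub_le (hw : IsDiscourseWalk εw walk) (hv : ∀ a, ‖v a‖ ≤ R * √d)
    (w : Fin n) {g : Discourse d → ℝ} (hg : Continuous g) (hg0 : ∀ c, 0 < g c)
    (hpos : 0 < ∫ c, wordProb v c w * g c ∂(uniformSphere d)) :
    0 < ∫ z, wordProb v z.1 w * g z.2 ∂((uniformSphere d) ⊗ₘ walk) ∧
    |Real.log (∫ z, wordProb v z.1 w * g z.2 ∂((uniformSphere d) ⊗ₘ walk)) -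
      Real.log (∫ c, wordProb v c w * g c ∂(uniformSphere d))| ≤ 2 * R * εw := by
  have hM := hw.markov
  have hcw := continuous_wordProb v w
  have hs := integral_snd_compProd walk hw.stationary (f := fun c => wordProb v c w * g c)
    (hcw.mul hg)
  have hint : ∀ f : Discourse d × Discourse d → ℝ, Continuous f →
      Integrable f ((uniformSphere d) ⊗ₘ walk) := fun f hf =>
    hf.integrable_of_hasCompactSupport (HasCompactSupport.of_compactSpace f)
  have hae := ae_norm_sub_le hw
  set I := ∫ c, wordProb v c w * g c ∂(uniformSphere d)
  have hup : ∫ z, wordProb v z.1 w * g z.2 ∂((uniformSphere d) ⊗ₘ walk) ≤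
      Real.exp (2 * R * εw) * I := by
    rw [← hs, ← integral_const_mul]
    refine integral_mono_ae (hint _ (by fun_prop)) (hint _ (by fun_prop)) ?_
    filter_upwards [hae] with z hz
    rw [← mul_assoc]
    have := hg0 z.2
    gcongr
    exact wordProb_le_of_norm_sub_le hv hz w
  have hlow : Real.exp (-(2 * R * εw)) * I ≤
      ∫ z, wordProb v z.1 w * g z.2 ∂((uniformSphere d) ⊗ₘ walk) := by
    rw [← hs, ← integral_const_mul]
    refine integral_mono_ae (hint _ (by fun_prop)) (hint _ (by fun_prop)) ?_
    filter_upwards [hae] with z hz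
    rw [← mul_assoc]
    have := hg0 z.2
    gcongr
    rw [norm_sub_rev] at hz
    have h := wordProb_le_of_norm_sub_le hv hz w
    rw [Real.exp_neg, inv_mul_le_iff₀ (Real.exp_pos _)]
    exact h
  have hp := lt_of_lt_of_le (mul_pos (Real.exp_pos (-(2 * R * εw))) hpos) hlow
  refine ⟨hp, ?_⟩
  have h1 := Real.log_le_log hp hup
  have h2 := Real.log_le_log (by positivity) hlow
  rw [Real.log_mul (by positivity) (by positivity), Real.log_exp] at h1 h2
  rw [abs_le]
  constructor <;> linarith

end Walk

/-! ### Cancellation in the pointwise mutual information -/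

section PMI

variable {n d : ℕ} [NeZero n] {v u : Fin n → EuclideanSpace ℝ (Fin d)}

omit [NeZero n] in
theorem integral_wordProb (a : Fin n) :
    ∫ c, wordProb v c a ∂(uniformSphere d) = logLinearMean v u 1 0 (v a) := by
  simp [logLinearMean, wordProb]

omit [NeZero n] in
theorem integral_wordProb_mul_wordProb (w a : Fin n) :
    ∫ c, wordProb v c w * wordProb v c a ∂(uniformSphere d) =
      logLinearMean v u 2 0 (v w + v a) := by
  refine integral_congr_ae (.of_forall fun c => ?_)
  simp only [wordProb, inner_add_left, Real.exp_add]
  rw [div_mul_div_comm]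
  ring_nf

omit [NeZero n] in
theorem integral_wordProb_mul_composed (a b : Fin n) :
    ∫ c, wordProb v c a * wordProb u c b ∂(uniformSphere d) =
      logLinearMean v u 1 1 (v a + u b) := by
  refine integral_congr_ae (.of_forall fun c => ?_)
  simp only [wordProb, inner_add_left, Real.exp_add, pow_one]
  rw [div_mul_div_comm]

omit [NeZero n] in
theorem integral_wordProb_mul_wordProb_mul_composed (w a b : Fin n) :
    ∫ c, wordProb v c w * (wordProb v c a * wordProb u c b) ∂(uniformSphere d) =
      logLinearMean v u 2 1 (v w + (v a + u b)) := by
  refine integral_congr_ae (.of_forall fun c => ?_)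
  simp only [wordProb, inner_add_left, Real.exp_add, pow_one]
  rw [div_mul_div_comm, div_mul_div_comm]
  ring_nf

/-- The value of `PMI3` when the discourse vector does not move between the two steps. -/
def staticPMI3 (v u : Fin n → EuclideanSpace ℝ (Fin d)) (a b w : Fin n) : ℝ :=
  Real.log (logLinearMean v u 2 1 (v w + (v a + u b))) +
    Real.log (logLinearMean v u 1 0 (v a)) + Real.log (logLinearMean v u 1 0 (v b)) +
    Real.log (logLinearMean v u 1 0 (v w)) - Real.log (logLinearMean v u 2 0 (v w + v a)) -
    Real.log (logLinearMean v u 2 0 (v w + v b)) - Real.log (logLinearMean v u 1 1 (v a + u b))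

variable [NeZero d]

/-- Only the triple and the two `pTwo` probabilities involve both discourse vectors; each
contributes `2Rεw`. -/
theorem abs_PMI3_sub_staticPMI3_le {T : Fin d → Fin d → Fin d → ℝ} {psyn εw R : ℝ}
    {walk : Kernel (Discourse d) (Discourse d)} (hw : IsDiscourseWalk εw walk)
    (h0 : 0 < psyn) (h1 : psyn < 1) (a b w : Fin n) (hv : ∀ a, ‖v a‖ ≤ R * √d)
    (hu : ∀ b, ‖composedVec v T a b‖ ≤ R * √d) :
    |PMI3 psyn walk v T a b w - staticPMI3 v (composedVec v T a) a b w| ≤ 6 * R * εw := by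
  have hM := hw.markov
  set u := composedVec v T a with hudef
  have hQ : ∀ i j x, i + j ≤ 3 → 0 < logLinearMean v u i j x := fun i j x hij =>
    logLinearMean_pos hij hv hu
  have e3 := pTriple_eq v T walk h0 h1 w a b
  have e2a := pTwo_eq v T walk h0 h1 w a
  have e2b := pTwo_eq v T walk h0 h1 w b
  have eP := pPair_eq v T walk hw.stationary h0 h1 a b
  have e1 := fun a => pOne_eq v T walk hw.stationary h0 h1 a
  rw [← hudef] at e3 eP
  simp only [integral_wordProb (v := v) (u := u)] at e1
  rw [integral_wordProb_mul_composed] at eP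
  obtain ⟨p3, l3⟩ := abs_log_integral_walk_sub_le hw hv w
    (g := fun c => wordProb v c a * wordProb u c b)
    ((continuous_wordProb v a).mul (continuous_wordProb u b))
    (fun c => mul_pos (wordProb_pos v c a) (wordProb_pos u c b))
    (by rw [integral_wordProb_mul_wordProb_mul_composed]; exact hQ _ _ _ (by norm_num))
  obtain ⟨p2a, l2a⟩ := abs_log_integral_walk_sub_le hw hv w (continuous_wordProb v a)
    (fun c => wordProb_pos v c a)
    (by rw [integral_wordProb_mul_wordProb (u := u)]; exact hQ _ _ _ (by norm_num))
  obtain ⟨p2b, l2b⟩ := abs_log_integral_walk_sub_le hw hv w (continuous_wordProb v b)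
    (fun c => wordProb_pos v c b)
    (by rw [integral_wordProb_mul_wordProb (u := u)]; exact hQ _ _ _ (by norm_num))
  rw [integral_wordProb_mul_wordProb_mul_composed] at l3
  rw [integral_wordProb_mul_wordProb (u := u)] at l2a l2b
  rw [← e3] at p3 l3
  rw [← e2a] at p2a l2a
  rw [← e2b] at p2b l2b
  have p1 : ∀ a, 0 < pOne psyn walk v T a := fun a => by
    rw [e1]; exact hQ _ _ _ (by norm_num)
  have pP : 0 < pPair psyn walk v T a b := by rw [eP]; exact hQ _ _ _ (by norm_num)
  have h1a := p1 a
  have h1b := p1 b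
  have h1w := p1 w
  rw [PMI3, Real.log_div (by positivity) (by positivity), Real.log_mul (by positivity)
    (by positivity), Real.log_mul (by positivity) (by positivity), Real.log_mul (by positivity)
    (by positivity), Real.log_mul (by positivity) (by positivity), Real.log_mul (by positivity)
    (by positivity), e1, e1, e1, eP, staticPMI3]
  rw [abs_le] at l3 l2a l2b ⊢
  constructor <;> linarith [l3.1, l3.2, l2a.1, l2a.2, l2b.1, l2b.2]

omit [NeZero n] [NeZero d] in
theorem norm_add_le_of_norm_le {x y : EuclideanSpace ℝ (Fin d)} {r s : ℝ}
    (hx : ‖x‖ ≤ r) (hy : ‖y‖ ≤ s) : ‖x + y‖ ≤ r + s :=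
  (norm_add_le _ _).trans (add_le_add hx hy)

/-- Each of the seven logarithms is `-(i + j) log n` up to `18 R²`, and the multiples of `log n`
cancel: `3 + 1 + 1 + 1 = 2 + 2 + 2`. -/
theorem abs_staticPMI3_le {R : ℝ} (hv : ∀ w, ‖v w‖ ≤ R * √d) (hu : ∀ w, ‖u w‖ ≤ R * √d)
    (a b w : Fin n) : |staticPMI3 v u a b w| ≤ 126 * R ^ 2 := by
  have h0 : 0 ≤ R * √d := (norm_nonneg _).trans (hv a)
  have b1 : ∀ a, ‖v a‖ ≤ 3 * R * √d := fun a => by linarith [hv a]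
  have l3 := abs_log_logLinearMean_add_le (i := 2) (j := 1) (x := v w + (v a + u b)) (by norm_num)
    hv hu (by linarith [norm_add_le_of_norm_le (hv w) (norm_add_le_of_norm_le (hv a) (hu b))])
  have l1 := fun a => abs_log_logLinearMean_add_le (i := 1) (j := 0) (by norm_num) hv hu (b1 a)
  have l2 := fun a => abs_log_logLinearMean_add_le (i := 2) (j := 0) (x := v w + v a) (by norm_num)
    hv hu (by linarith [norm_add_le_of_norm_le (hv w) (hv a)])
  have lP := abs_log_logLinearMean_add_le (i := 1) (j := 1) (x := v a + u b) (by norm_num)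
    hv hu (by linarith [norm_add_le_of_norm_le (hv a) (hu b)])
  have l1a := l1 a
  have l1b := l1 b
  have l1w := l1 w
  have l2a := l2 a
  have l2b := l2 b
  push_cast at l3 l1a l1b l1w l2a l2b lP
  rw [abs_le] at l3 l1a l1b l1w l2a l2b lP ⊢
  rw [staticPMI3]
  constructor <;> linarith [l3.1, l3.2, l1a.1, l1a.2, l1b.1, l1b.2, l1w.1, l1w.2, l2a.1, l2a.2,
    l2b.1, l2b.2, lP.1, lP.2]

theorem abs_staticPMI3_sub_le {R Z Z' ε ε' s : ℝ} {G : Set (Discourse d)}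
    (hv : ∀ w, ‖v w‖ ≤ R * √d) (hu : ∀ w, ‖u w‖ ≤ R * √d)
    (hZ : 0 < Z) (hZ' : 0 < Z') (hε : 0 ≤ ε) (hε1 : ε ≤ 1 / 2) (hε' : 0 ≤ ε') (hε1' : ε' ≤ 1 / 2)
    (hG : MeasurableSet G) (hs : 0 < s) (hμ : (uniformSphere d).real Gᶜ ≤ s ^ 2)
    (hGv : ∀ c ∈ G, (1 - ε) * Z ≤ partitionFn v c ∧ partitionFn v c ≤ (1 + ε) * Z)
    (hGu : ∀ c ∈ G, (1 - ε') * Z' ≤ partitionFn u c ∧ partitionFn u c ≤ (1 + ε') * Z')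
    (hsmall : s * Real.exp (90 * R ^ 2) ≤ 1 / 2) (hd : 21 * R ^ 4 / d ≤ 1 / 2) (a b w : Fin n) :
    |staticPMI3 v u a b w - 1 / d * inner ℝ (v w) (u b - v b)| ≤
      7 * (6 * (ε + ε') + 2 * (s * Real.exp (90 * R ^ 2)) + 42 * R ^ 4 / d) := by
  have hd0 : (0 : ℝ) < d := Nat.cast_pos.2 (NeZero.pos d)
  have h0 : 0 ≤ R * √d := (norm_nonneg _).trans (hv a)
  have b1 : ∀ a, ‖v a‖ ≤ 3 * R * √d := fun a => by linarith [hv a]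
  have key : ∀ (i j : ℕ) (x : EuclideanSpace ℝ (Fin d)), i + j ≤ 3 → ‖x‖ ≤ 3 * R * √d → _ :=
    fun i j x hij hx => abs_log_logLinearMean_sub_le (i := i) (j := j) (x := x) hij hv hu hx hZ hZ'
      hε hε1 hε' hε1' hG hs hμ hGv hGu hsmall hd
  have l3 := key 2 1 (v w + (v a + u b)) (by norm_num)
    (by linarith [norm_add_le_of_norm_le (hv w) (norm_add_le_of_norm_le (hv a) (hu b))])
  have l1a := key 1 0 _ (by norm_num) (b1 a)
  have l1b := key 1 0 _ (by norm_num) (b1 b)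
  have l1w := key 1 0 _ (by norm_num) (b1 w)
  have l2a := key 2 0 (v w + v a) (by norm_num) (by linarith [norm_add_le_of_norm_le (hv w) (hv a)])
  have l2b := key 2 0 (v w + v b) (by norm_num) (by linarith [norm_add_le_of_norm_le (hv w) (hv b)])
  have lP := key 1 1 (v a + u b) (by norm_num) (by linarith [norm_add_le_of_norm_le (hv a) (hu b)])
  -- All squares cancel, leaving the cross terms `⟪v w, v a + u b⟫ - ⟪v w, v a⟫ - ⟪v w, v b⟫`. The
  -- exponents of `Z` and `Z'` also add up to zero.
  have hid : ‖v w + (v a + u b)‖ ^ 2 / (2 * d) + ‖v a‖ ^ 2 / (2 * d) + ‖v b‖ ^ 2 / (2 * d) +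
      ‖v w‖ ^ 2 / (2 * d) - ‖v w + v a‖ ^ 2 / (2 * d) - ‖v w + v b‖ ^ 2 / (2 * d) -
      ‖v a + u b‖ ^ 2 / (2 * d) = 1 / d * inner ℝ (v w) (u b - v b) := by
    rw [norm_add_sq_real (v w), norm_add_sq_real (v w), norm_add_sq_real (v w), inner_add_right,
      inner_sub_right]
    field_simp
    ring
  push_cast at l3 l1a l1b l1w l2a l2b lP
  rw [abs_le] at l3 l1a l1b l1w l2a l2b lP ⊢
  rw [staticPMI3, ← hid]
  constructor <;> linarith [l3.1, l3.2, l1a.1, l1a.2, l1b.1, l1b.2, l1w.1, l1w.2, l2a.1, l2a.2,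
    l2b.1, l2b.2, lP.1, lP.2]

end PMI

/-! ### Assembling the error bound -/

theorem exp_neg_sq_log_le {c₀ : ℝ} (hc₀ : 0 < c₀) {n : ℕ} (hn : 0 < n) :
    Real.exp (-(c₀ * Real.log n ^ 2 / 2)) ≤ Real.exp (1 / (8 * c₀)) / √n := by
  have hn' : (0 : ℝ) < n := Nat.cast_pos.2 hn
  have h1 : √(n : ℝ) = Real.exp (Real.log n / 2) := by
    rw [Real.sqrt_eq_rpow, Real.rpow_def_of_pos hn']
    ring_nf
  rw [h1, ← Real.exp_sub, Real.exp_le_exp]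
  -- Completing the square in `log n` yields the constant `1 / (8 c₀)`.
  have : 1 / (8 * c₀) - Real.log n / 2 + c₀ * Real.log n ^ 2 / 2 =
      (2 * c₀ * Real.log n - 1) ^ 2 / (8 * c₀) := by
    field_simp
    ring
  have h2 : 0 ≤ (2 * c₀ * Real.log n - 1) ^ 2 / (8 * c₀) := by positivity
  linarith

theorem norm_composedVec_le {n d : ℕ} {v : Fin n → EuclideanSpace ℝ (Fin d)}
    {T : Fin d → Fin d → Fin d → ℝ} {B K ε : ℝ} (hv : ∀ a, ‖v a‖ ≤ B * √d)
    (hT : IsBoundedTensor K ε v T) (a b : Fin n) : ‖composedVec v T a b‖ ≤ (|B| + √K) * √d := by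
  have h1 : ‖tensorVec T (v a) (v b)‖ ≤ √K * √d := by
    rw [← Real.sqrt_mul' _ (Nat.cast_nonneg d)]
    exact Real.le_sqrt_of_sq_le (hT.vec a b)
  have h2 : B * √d ≤ |B| * √d := by
    gcongr
    exact le_abs_self B
  calc _ ≤ ‖v b‖ + ‖tensorVec T (v a) (v b)‖ := norm_add_le _ _
    _ ≤ _ := by linarith [hv b]

theorem ConcentrationEvents.exists_good {n d : ℕ} [NeZero n] [NeZero d]
    {v : Fin n → EuclideanSpace ℝ (Fin d)} {T : Fin d → Fin d → Fin d → ℝ} {εz δ s : ℝ}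
    {εza : Fin n → ℝ} (h : ConcentrationEvents v T εz εza δ) (a : Fin n) (hδ : 2 * δ ≤ s ^ 2)
    (hδ1 : δ < 1) (hz : εz ≤ 1 / 2) (hz0 : 0 ≤ εz) (hza : εza a ≤ 1 / 2) (hza0 : 0 ≤ εza a) :
    ∃ (Z Z' : ℝ) (G : Set (Discourse d)), 0 < Z ∧ 0 < Z' ∧ MeasurableSet G ∧
      (uniformSphere d).real Gᶜ ≤ s ^ 2 ∧
      (∀ c ∈ G, (1 - εz) * Z ≤ partitionFn v c ∧ partitionFn v c ≤ (1 + εz) * Z) ∧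
      ∀ c ∈ G, (1 - εza a) * Z' ≤ partitionFn (composedVec v T a) c ∧
        partitionFn (composedVec v T a) c ≤ (1 + εza a) * Z' := by
  have key : ∀ (u : Fin n → EuclideanSpace ℝ (Fin d)) (ε Z : ℝ), 0 ≤ ε → ε ≤ 1 / 2 →
      1 - δ ≤ (uniformSphere d).real
        {c | (1 - ε) * Z ≤ partitionFn u c ∧ partitionFn u c ≤ (1 + ε) * Z} →
      0 < Z ∧ MeasurableSet {c | (1 - ε) * Z ≤ partitionFn u c ∧ partitionFn u c ≤ (1 + ε) * Z} ∧
        (uniformSphere d).real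
          {c | (1 - ε) * Z ≤ partitionFn u c ∧ partitionFn u c ≤ (1 + ε) * Z}ᶜ ≤ δ := by
    intro u ε Z h0 h1 hp
    have hc := continuous_partitionFn u
    have hm : MeasurableSet
        {c | (1 - ε) * Z ≤ partitionFn u c ∧ partitionFn u c ≤ (1 + ε) * Z} :=
      (measurableSet_le measurable_const hc.measurable).inter
        (measurableSet_le hc.measurable measurable_const)
    refine ⟨?_, hm, ?_⟩
    -- The constant `Z` is not assumed positive. As `δ < 1` the event is nonempty, and one of its
    -- points forces `Z > 0`.
    · have hne : {c | (1 - ε) * Z ≤ partitionFn u c ∧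
          partitionFn u c ≤ (1 + ε) * Z}.Nonempty := by
        rw [Set.nonempty_iff_ne_empty]
        intro he
        rw [he, measureReal_empty] at hp
        linarith
      obtain ⟨c, -, hc2⟩ := hne
      exact pos_of_mul_pos_right ((partitionFn_pos u c).trans_le hc2) (by linarith)
    · rw [measureReal_compl hm, probReal_univ]
      linarith
  obtain ⟨Z, hZ⟩ := h.first
  obtain ⟨Z', hZ'⟩ := h.second a
  rw [partitionFn₂_eq] at hZ'
  obtain ⟨p1, m1, q1⟩ := key _ _ _ hz0 hz hZ
  obtain ⟨p2, m2, q2⟩ := key _ _ _ hza0 hza hZ'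
  refine ⟨Z, Z', _, p1, p2, m1.inter m2, ?_, fun c hc => hc.1, fun c hc => hc.2⟩
  rw [Set.compl_inter]
  refine (measureReal_union_le _ _).trans ?_
  linarith

theorem isTuckerDecomposition_triApply {n d : ℕ} (v : Fin n → EuclideanSpace ℝ (Fin d))
    (T : Fin d → Fin d → Fin d → ℝ) :
    IsTuckerDecomposition (fun a b w => 1 / d * triApply T (v a) (v b) (v w))
      (fun i j k => 1 / d * T i j k) (Matrix.of fun a i => v a i) (Matrix.of fun b j => v b j)
      (Matrix.of fun w k => v w k) := by
  intro a b w
  simp only [triApply, Finset.mul_sum, Matrix.of_apply, mul_assoc]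

/-- The constant in the error bound for `PMI3`. -/
def errorConst (A c₀ R : ℝ) : ℝ :=
  |A| + 2 * Real.exp (1 / (8 * c₀)) * Real.exp (90 * R ^ 2) + 21 * R ^ 4

/-- The radius `R = |B| + √K` bounds both `v` and `u` in units of `√d`. In the coefficient, `6R` is
the cost of the walk, `84 = 7 * 12` comes from seven logarithms in the small-error regime, and `254
R² = 2 * (126 + 1) R²` from the trivial bound in the large-error regime. -/
theorem abs_PMI3_sub_le {B K A c₀ : ℝ} (p : ℕ) (hc₀ : 0 < c₀) {n d : ℕ} (hd : 0 < d)
    {psyn ε εw : ℝ} (h0 : 0 < psyn) (h1 : psyn < 1) (hε : 0 ≤ ε)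
    {walk : Kernel (Discourse d) (Discourse d)} (hw : IsDiscourseWalk εw walk)
    {v : Fin n → EuclideanSpace ℝ (Fin d)} {T : Fin d → Fin d → Fin d → ℝ}
    (hv : ∀ a, ‖v a‖ ≤ B * √d) (hT : IsBoundedTensor K ε v T)
    {εz : ℝ} {εza : Fin n → ℝ} {δ : ℝ}
    (hz0 : 0 ≤ εz) (hz : εz ≤ A * ((1 + Real.log n) ^ p / √n))
    (hza0 : ∀ a, 0 ≤ εza a) (hza : ∀ a, εza a ≤ A * (ε + (1 + Real.log n) ^ p / √n))
    (hδ : δ ≤ Real.exp (-(c₀ * Real.log n ^ 2)))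
    (hcon : ConcentrationEvents v T εz εza δ) (a b w : Fin n) :
    |PMI3 psyn walk v T a b w - 1 / d * triApply T (v a) (v b) (v w)| ≤
      (6 * (|B| + √K) + (84 + 254 * (|B| + √K) ^ 2) * errorConst A c₀ (|B| + √K)) *
        (ε + εw + (1 + Real.log n) ^ p / √n + (1 + Real.log d) ^ p / d) := by
  have : NeZero d := ⟨hd.ne'⟩
  have hn : 0 < n := a.pos
  have : NeZero n := ⟨hn.ne'⟩
  have hd' : (0 : ℝ) < d := Nat.cast_pos.2 hd
  have hn' : (0 : ℝ) < n := Nat.cast_pos.2 hn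
  have hsn : (0 : ℝ) < √n := Real.sqrt_pos.2 hn'
  have hu := norm_composedVec_le hv hT a
  set R := |B| + √K with hR
  have hR0 : 0 ≤ R := by positivity
  have hvR : ∀ a, ‖v a‖ ≤ R * √d := fun a => (hv a).trans <| by
    gcongr
    rw [hR]
    linarith [le_abs_self B, Real.sqrt_nonneg K]
  have hεw := hw.nonneg
  set N := (1 + Real.log n) ^ p / √n with hN
  set D := (1 + Real.log d) ^ p / d with hD
  have hlogn := Real.log_natCast_nonneg n
  have hlogd := Real.log_natCast_nonneg d
  have hN1 : 1 / √n ≤ N := by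
    rw [hN]
    gcongr
    exact one_le_pow₀ (by linarith)
  have hD1 : 1 / d ≤ D := by
    rw [hD]
    gcongr
    exact one_le_pow₀ (by linarith)
  have hN0 : 0 < N := lt_of_lt_of_le (by positivity) hN1
  have hD0 : 0 < D := lt_of_lt_of_le (by positivity) hD1
  set Err := ε + εw + N + D with hErr
  have hErr0 : 0 < Err := by positivity
  set u := composedVec v T a with hudef
  have hub : u b - v b = tensorVec T (v a) (v b) := by simp [hudef, composedVec]
  have htri : triApply T (v a) (v b) (v w) = inner ℝ (v w) (u b - v b) := by
    rw [hub, ← inner_tensorVec, real_inner_comm]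
  have hwalk := abs_PMI3_sub_staticPMI3_le hw h0 h1 a b w hvR hu
  rw [← hudef] at hwalk
  have hwalk' : 6 * R * εw ≤ 6 * R * Err := by
    gcongr
    linarith
  set κ₀ := 2 * Real.exp (1 / (8 * c₀)) * Real.exp (90 * R ^ 2) with hκ₀
  have hκ₀0 : 0 < κ₀ := by positivity
  set H := errorConst A c₀ R with hH
  have hHdef : H = |A| + κ₀ + 21 * R ^ 4 := rfl
  have hH0 : 0 < H := by rw [hHdef]; positivity
  have hmain : |staticPMI3 v u a b w - 1 / d * triApply T (v a) (v b) (v w)| ≤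
      (84 + 254 * R ^ 2) * H * Err := by
    have hHE : 0 < H * Err := by positivity
    -- Smallness of `H * Err` yields at once all the thresholds `1/2` that the concentration
    -- estimate needs; otherwise `1 ≤ 2 * (H * Err)` and crude bounds suffice.
    by_cases hsm : H * Err ≤ 1 / 2
    · have hexp : H * Err = |A| * Err + κ₀ * Err + 21 * R ^ 4 * Err := by rw [hHdef]; ring
      have hA0 : 0 ≤ |A| * Err := by positivity
      have hκ0 : 0 ≤ κ₀ * Err := by positivity
      have hRE0 : 0 ≤ 21 * R ^ 4 * Err := by positivity
      have hzE : εz ≤ |A| * Err := hz.trans <| by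
        calc A * N ≤ |A| * N := by gcongr; exact le_abs_self A
          _ ≤ |A| * Err := by gcongr; linarith
      have hzaE : εza a ≤ |A| * Err := (hza a).trans <| by
        calc A * (ε + N) ≤ |A| * (ε + N) := by gcongr; exact le_abs_self A
          _ ≤ |A| * Err := by gcongr; linarith
      have hdE : 21 * R ^ 4 / d ≤ 21 * R ^ 4 * Err := by
        rw [div_eq_mul_one_div]
        gcongr
        linarith
      -- Then `s² = 4 exp (-c₀ log² n)`, which covers the measure `2δ` of two exceptional events
      -- and, since `s ≤ 1/2`, also gives `δ < 1`.
      set s := 2 * Real.exp (-(c₀ * Real.log n ^ 2 / 2)) with hs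
      have hs0 : 0 < s := by positivity
      have hsE : s * Real.exp (90 * R ^ 2) ≤ κ₀ * Err := by
        calc s * Real.exp (90 * R ^ 2)
            ≤ 2 * (Real.exp (1 / (8 * c₀)) / √n) * Real.exp (90 * R ^ 2) := by
              rw [hs]
              gcongr
              exact exp_neg_sq_log_le hc₀ hn
          _ = κ₀ * (1 / √n) := by rw [hκ₀]; ring
          _ ≤ κ₀ * Err := by gcongr; linarith
      have hs2 : s ^ 2 = 4 * Real.exp (-(c₀ * Real.log n ^ 2)) := by
        rw [hs, mul_pow, ← Real.exp_nat_mul]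
        push_cast
        ring_nf
      have hs_half : s ≤ 1 / 2 := by
        have := le_mul_of_one_le_right hs0.le
          (Real.one_le_exp (show 0 ≤ 90 * R ^ 2 by positivity))
        linarith
      have hδs : 4 * δ ≤ s ^ 2 := by rw [hs2]; linarith
      have hs24 : s ^ 2 ≤ 1 := pow_le_one₀ hs0.le (by linarith)
      have hδ2 : 2 * δ ≤ s ^ 2 := by
        rw [hs2]
        linarith [Real.exp_pos (-(c₀ * Real.log n ^ 2))]
      obtain ⟨Z, Z', G, hZ, hZ', hG, hμ, hGv, hGu⟩ := hcon.exists_good (s := s) a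
        hδ2 (by linarith) (by linarith) hz0
        (by linarith) (hza0 a)
      have h := abs_staticPMI3_sub_le hvR hu hZ hZ' hz0 (by linarith) (hza0 a) (by linarith) hG hs0
        hμ hGv hGu (by linarith) (by linarith) a b w
      rw [htri]
      have h42 : 42 * R ^ 4 / d = 2 * (21 * R ^ 4 / d) := by ring
      have h254 : 0 ≤ 254 * R ^ 2 * (H * Err) := by positivity
      calc _ ≤ _ := h
        _ ≤ 84 * (H * Err) := by rw [h42]; linarith
        _ ≤ _ := by linarith
    · have hb1 := abs_staticPMI3_le hvR hu a b w
      have hb2 : |1 / d * triApply T (v a) (v b) (v w)| ≤ R ^ 2 := by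
        have ht : ‖tensorVec T (v a) (v b)‖ ≤ R * √d := by
          refine (Real.le_sqrt_of_sq_le (hT.vec a b)).trans ?_
          rw [Real.sqrt_mul' _ hd'.le]
          gcongr
          rw [hR]
          linarith [abs_nonneg B]
        rw [htri, hub, abs_mul, abs_of_pos (by positivity : (0 : ℝ) < 1 / d), one_div,
          inv_mul_le_iff₀ hd']
        calc _ ≤ ‖v w‖ * ‖tensorVec T (v a) (v b)‖ := abs_real_inner_le_norm _ _
          _ ≤ (R * √d) * (R * √d) := by gcongr; exact hvR w
          _ = d * R ^ 2 := by
            rw [mul_mul_mul_comm, Real.mul_self_sqrt hd'.le]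
            ring
      have hlarge : R ^ 2 * 1 ≤ R ^ 2 * (2 * (H * Err)) := by gcongr; linarith
      calc _ ≤ |staticPMI3 v u a b w| + |1 / d * triApply T (v a) (v b) (v w)| := abs_sub _ _
        _ ≤ 127 * (R ^ 2 * (2 * (H * Err))) := by linarith
        _ ≤ _ := by linarith
  calc _ ≤ |PMI3 psyn walk v T a b w - staticPMI3 v u a b w| +
        |staticPMI3 v u a b w - 1 / d * triApply T (v a) (v b) (v w)| := abs_sub_le _ _ _
    _ ≤ 6 * R * Err + (84 + 254 * R ^ 2) * H * Err := add_le_add (hwalk.trans hwalk') hmain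
    _ = _ := by ring

end

end SyntacticRandWalk

theorem corollary1 (B K A c₀ : ℝ) (p : ℕ) (hc₀ : 0 < c₀) :
    ∃ (C : ℝ) (q : ℕ), ∀ (n d : ℕ), 0 < d →
      ∀ (psyn ε εw : ℝ), 0 < psyn → psyn < 1 → 0 ≤ ε →
      ∀ (walk : ProbabilityTheory.Kernel (SyntacticRandWalk.Discourse d)
          (SyntacticRandWalk.Discourse d)),
        SyntacticRandWalk.IsDiscourseWalk εw walk →
      ∀ (v : Fin n → EuclideanSpace ℝ (Fin d)) (T : Fin d → Fin d → Fin d → ℝ),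
        (∀ a, ‖v a‖ ≤ B * √d) →
        SyntacticRandWalk.IsBoundedTensor K ε v T →
      ∀ (εz : ℝ) (εza : Fin n → ℝ) (δ : ℝ),
        0 ≤ εz → εz ≤ A * ((1 + Real.log n) ^ p / √n) →
        (∀ a, 0 ≤ εza a) → (∀ a, εza a ≤ A * (ε + (1 + Real.log n) ^ p / √n)) →
        δ ≤ Real.exp (-(c₀ * Real.log n ^ 2)) →
        SyntacticRandWalk.ConcentrationEvents v T εz εza δ →
        (∀ a b w : Fin n,
          |SyntacticRandWalk.PMI3 psyn walk v T a b w -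
              1 / d * SyntacticRandWalk.triApply T (v a) (v b) (v w)| ≤
            C * (ε + εw + (1 + Real.log n) ^ q / √n + (1 + Real.log d) ^ q / d)) ∧
        ∃ X : Fin n → Fin n → Fin n → ℝ,
          SyntacticRandWalk.IsTuckerDecomposition X (fun i j k => 1 / d * T i j k)
            (Matrix.of fun a i => v a i) (Matrix.of fun b j => v b j)
            (Matrix.of fun w k => v w k) ∧
          ∀ a b w : Fin n,
            |SyntacticRandWalk.PMI3 psyn walk v T a b w - X a b w| ≤
              C * (ε + εw + (1 + Real.log n) ^ q / √n + (1 + Real.log d) ^ q / d) := by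
  -- The exponent `q = p` serves the `1/d` term as well, because `(1 + log d) ^ p ≥ 1`; the constant
  -- `C` is read off from `abs_PMI3_sub_le`.
  refine ⟨_, p, fun n d hd psyn ε εw h0 h1 hε walk hw v T hv hT εz εza δ hz0 hz hza0 hza hδ hcon =>
    have h := SyntacticRandWalk.abs_PMI3_sub_le p hc₀ hd h0 h1 hε hw hv hT hz0 hz hza0 hza hδ hcon
    ⟨h, _, SyntacticRandWalk.isTuckerDecomposition_triApply v T, h⟩⟩
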